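/- Let $r>0$ and let $H^3_r=\{X\in\mathbb R^4: x_1^2+x_2^2+x_3^2-x_4^2=-r^2,\ x_4>0\}$ be hyperbolic $3$-space of curvature radius $r$ (constant sectional curvature $-1/r^2$), with the Riemannian metric induced by the Minkowski form. For every $a>0$ there are regular geodesic tetrahedra in $H^3_r$ all of whose edges have geodesic length $a$, and they all have the same (Riemannian) volume $V^{H^3_r}(r,a)$. Let $\mathrm{Cl}_2(\theta)=-\int_0^\theta\log|2\sin(t/2)|\,dt$, let $\mathrm{Li}_2(z)=\sum_{n\ge1}z^n/n^2$ for $|z|\le1$, and let $\Psi^{1}=(\log\Gamma)''$ be the trigamma function. Then $$V^{H^3_r}(r,a)\le \mathrm{Cl}_2(\pi/3)\,r^3\quad(a>0),\qquad \lim_{a\to\infty}V^{H^3_r}(r,a)=\mathrm{Cl}_2(\pi/3)\,r^3,$$ where $$\mathrm{Cl}_2\!\left(\tfrac{\pi}{3}\right)=\operatorname{Im}\,\mathrm{Li}_2\!\left(e^{i\pi/3}\right)=\frac{\sqrt3}{6}\left(\Psi^{1}\!\left(\tfrac13\right)-\tfrac23\pi^2\right)=1.0149416064096536250\ldots,$$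 the decimal value being correct up to an error less than $5\cdot10^{-20}$. Moreover, regular ideal tetrahedra (four distinct vertices at infinity, every permutation of which is induced by an isometry of $H^3_r$) exist in $H^3_r$, and each of them has volume exactly $\mathrm{Cl}_2(\pi/3)\,r^3$. -/

import Mathlib

open MeasureTheory Filter Topology

noncomputable section

/-- The Minkowski form `x₁y₁ + x₂y₂ + x₃y₃ - x₄y₄` on `ℝ⁴` (the time coordinate is the last one). -/
def minkowski (X Y : Fin 4 → ℝ) : ℝ :=
  X 0 * Y 0 + X 1 * Y 1 + X 2 * Y 2 - X 3 * Y 3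

/-- Hyperbolic space `H³_r` of curvature radius `r`: the upper sheet of the hyperboloid
`⟨X, X⟩ = -r²` in Minkowski space. -/
def hyperboloid (r : ℝ) : Set (Fin 4 → ℝ) :=
  {X | minkowski X X = -r ^ 2 ∧ 0 < X 3}

/-- The geodesic distance of `H³_r`, given by `cosh (d / r) = -⟨X, Y⟩ / r²`. -/
def hyperbolicDist (r : ℝ) (X Y : Fin 4 → ℝ) : ℝ :=
  r * Real.arcosh (-minkowski X Y / r ^ 2)

/-- The open ball of radius `r` in `ℝ³`, the domain of the Klein coordinates. -/
def kleinBall (r : ℝ) : Set (Fin 3 → ℝ) :=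
  {x | x 0 ^ 2 + x 1 ^ 2 + x 2 ^ 2 < r ^ 2}

/-- The Cayley-Klein-Hilbert parametrization `kleinBall r → H³_r`: the point of the hyperboloid on
the ray from the origin through `(x, r)`. It is a diffeomorphism onto `H³_r` in which the
geodesics are straight segments. -/
def kleinChart (r : ℝ) (x : Fin 3 → ℝ) : Fin 4 → ℝ :=
  (r / √(r ^ 2 - (x 0 ^ 2 + x 1 ^ 2 + x 2 ^ 2))) • ![x 0, x 1, x 2, r]

/-- The matrix `g_{AB}` in Klein coordinates of the Riemannian metric that Minkowski space induces
on `H³_r`: the Minkowski products of the coordinate tangent vectors. -/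
def kleinMetric (r : ℝ) (x : Fin 3 → ℝ) : Matrix (Fin 3) (Fin 3) ℝ :=
  Matrix.of fun A B =>
    minkowski (fderiv ℝ (kleinChart r) x (Pi.single A 1))
      (fderiv ℝ (kleinChart r) x (Pi.single B 1))

/-- The Riemannian volume of `S ⊆ H³_r`: the integral of `√|det g|` over the image of `S` in the
(global) Klein coordinates. -/
def hyperbolicVolume (r : ℝ) (S : Set (Fin 4 → ℝ)) : ENNReal :=
  ∫⁻ x in {x | x ∈ kleinBall r ∧ kleinChart r x ∈ S},
    ENNReal.ofReal (√|(kleinMetric r x).det|)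

/-- The geodesic tetrahedron in `H³_r` with vertices `v 0, …, v 3`. Geodesics of `H³_r` are the
intersections of `H³_r` with planes through the origin, so the geodesically convex hull of the
`v i` is the intersection of `H³_r` with the convex cone spanned by the `v i`. When the `v i` are
lightlike, this is the ideal tetrahedron whose vertices are the points at infinity represented by
the rays through the `v i`. -/
def geodesicTetrahedron (r : ℝ) (v : Fin 4 → Fin 4 → ℝ) : Set (Fin 4 → ℝ) :=
  {X | X ∈ hyperboloid r ∧ ∃ c : Fin 4 → ℝ, (∀ i, 0 ≤ c i) ∧ X = ∑ i, c i • v i}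

/-- `v` lists the vertices of a regular tetrahedron in `H³_r` all of whose edges have geodesic
length `a`. -/
def IsRegularTetrahedron (r a : ℝ) (v : Fin 4 → Fin 4 → ℝ) : Prop :=
  (∀ i, v i ∈ hyperboloid r) ∧ ∀ i j, i ≠ j → hyperbolicDist r (v i) (v j) = a

/-- `L` restricts to an isometry of `H³_r`: it preserves the Minkowski form and the upper sheet. -/
def IsHyperbolicIsometry (r : ℝ) (L : (Fin 4 → ℝ) →ₗ[ℝ] (Fin 4 → ℝ)) : Prop :=
  (∀ X Y, minkowski (L X) (L Y) = minkowski X Y) ∧ ∀ X ∈ hyperboloid r, L X ∈ hyperboloid r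

/-- The rays through `u 0, …, u 3` are the vertices of a regular ideal tetrahedron: they are four
distinct points at infinity (future-directed lightlike rays), and every permutation of them is
induced by an isometry of `H³_r`. -/
def IsRegularIdealTetrahedron (r : ℝ) (u : Fin 4 → Fin 4 → ℝ) : Prop :=
  (∀ i, minkowski (u i) (u i) = 0 ∧ 0 < u i 3) ∧
  (∀ i j, i ≠ j → ∀ t : ℝ, u i ≠ t • u j) ∧
  ∀ σ : Equiv.Perm (Fin 4), ∃ L : (Fin 4 → ℝ) →ₗ[ℝ] (Fin 4 → ℝ),
    IsHyperbolicIsometry r L ∧ ∀ i, ∃ t : ℝ, 0 < t ∧ L (u i) = t • u (σ i)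

/-- The Clausen function of order two, `Cl₂(θ) = -∫₀^θ log |2 sin (t / 2)| dt`. -/
def clausenTwo (θ : ℝ) : ℝ :=
  -∫ t in (0 : ℝ)..θ, Real.log |2 * Real.sin (t / 2)|

/-- The dilogarithm `Li₂(z) = ∑_{n ≥ 1} zⁿ / n²` on the closed unit disk. -/
def dilog (z : ℂ) : ℂ :=
  ∑' n : ℕ, z ^ (n + 1) / ((n : ℂ) + 1) ^ 2

/-- The trigamma function `Ψ¹ = (log Γ)''`, the derivative of the digamma function `Γ' / Γ`. -/
def trigamma (x : ℝ) : ℝ :=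
  deriv (logDeriv Real.Gamma) x

end

/-! Hyperbolic volume is Lebesgue measure of a cone in `ℝ⁴`. In Klein coordinates `√|det g| = 1 /
f²` with `f = -⟨(x, r), (x, r)⟩ / r²`, and slicing by height (`volume_cone`) shows that a
tetrahedron has volume `4 r³` times the measure of the part of its cone where `0 < -⟨X, X⟩ < 1`.
Rescaling the vertices does not change the cone. Once their Gram matrix is `-s` on the diagonal and
`-1` off it, coordinates along the vertices give the volume `4 r³ √((1 - s)³ (3 + s)) · vol
(gramRegion s)` (`hyperbolicVolume_geodesicTetrahedron`). Edge length `a` means `s = 1 / cosh (a /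
r)`; regular ideal tetrahedra are the case `s = 0`. Both factors are at most their values at `s = 0`
and tend to them as `s` decreases to `0`, so the bound, the limit and the ideal volume all follow
from `vol (gramRegion 0)`.

That number comes from `volume_cone` read backwards: it is an integral of `(xy + yz + zx + x + y +
z)⁻²` over the positive octant. Two elementary integrations leave `(2 log (x + 1) - log x) / (x² + x
+ 1)`, and `x = sin t / sin (π/3 - t)` turns this into log-sine integrals, that is, Clausen values.

For the constant itself, `Cl₂(θ) = ∑ sin (nθ) / n²` by Abel summation. Duplication moves `π/3` to
`2π/3`, where the series splits by residues mod 3; this yields the trigamma expression, and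
telescoping Euler-Maclaurin bounds yield the decimals. -/

/-! ### The sine series of the Clausen function -/

/-- Take real parts in the Taylor series of `-log (1 - z)` at `z = ρ e^{it}` and integrate termwise,
dominated by `ρⁿ`. The term `n = 0` vanishes because division by zero gives zero. -/
theorem hasSum_pow_mul_sin_div_sq (θ : ℝ) {ρ : ℝ} (h0 : 0 ≤ ρ) (h1 : ρ < 1) :
    HasSum (fun n : ℕ => ρ ^ n * (Real.sin (n * θ) / (n : ℝ) ^ 2))
      (-∫ t in (0 : ℝ)..θ, Real.log ‖1 - (ρ : ℂ) * Complex.exp (Complex.I * t)‖) := by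
  have key : HasSum (fun n : ℕ => ∫ t in (0 : ℝ)..θ, ρ ^ n * (Real.cos (n * t) / n))
      (∫ t in (0 : ℝ)..θ, -Real.log ‖1 - (ρ : ℂ) * Complex.exp (Complex.I * t)‖) := by
    refine intervalIntegral.hasSum_integral_of_dominated_convergence
      (fun n _ => ρ ^ n) ?_ ?_ ?_ ?_ ?_
    · intro n
      exact Continuous.aestronglyMeasurable (by fun_prop)
    · intro n
      refine Eventually.of_forall fun t _ => ?_
      rw [norm_mul, norm_pow, Real.norm_of_nonneg h0]
      refine mul_le_of_le_one_right (by positivity) ?_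
      rcases Nat.eq_zero_or_pos n with rfl | hn
      · simp
      · rw [norm_div, Real.norm_natCast]
        have : (1 : ℝ) ≤ n := by exact_mod_cast hn
        exact div_le_one_of_le₀ ((Real.abs_cos_le_one _).trans this) (by positivity)
    · exact Eventually.of_forall fun t _ => summable_geometric_of_lt_one h0 h1
    · exact intervalIntegrable_const
    · refine Eventually.of_forall fun t _ => ?_
      have hz : ‖(ρ : ℂ) * Complex.exp (Complex.I * t)‖ < 1 := by
        rw [norm_mul, Complex.norm_exp_I_mul_ofReal, mul_one, Complex.norm_real,
          Real.norm_of_nonneg h0]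
        exact h1
      have := Complex.hasSum_re (Complex.hasSum_taylorSeries_neg_log hz)
      rw [Complex.neg_re, Complex.log_re] at this
      refine this.congr_fun fun n => ?_
      have e : (n : ℂ) * (Complex.I * t) = ((n * t : ℝ) : ℂ) * Complex.I := by push_cast; ring
      rw [mul_pow, ← Complex.exp_nat_mul, e, ← Complex.ofReal_natCast, Complex.div_ofReal_re,
        ← Complex.ofReal_pow, Complex.re_ofReal_mul, Complex.exp_ofReal_mul_I_re, mul_div_assoc]
  rw [intervalIntegral.integral_neg] at key
  refine key.congr_fun fun n => ?_
  rw [intervalIntegral.integral_const_mul, intervalIntegral.integral_div]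
  rcases Nat.eq_zero_or_pos n with rfl | hn
  · simp
  · have hn' : (n : ℝ) ≠ 0 := by positivity
    rw [intervalIntegral.integral_comp_mul_left _ hn', integral_cos]
    rw [mul_zero, Real.sin_zero, sub_zero, smul_eq_mul]
    field_simp

theorem countable_setOf_sin_eq_zero : {t : ℝ | Real.sin t = 0}.Countable := by
  refine (Set.countable_range fun n : ℤ => (n : ℝ) * Real.pi).mono fun t ht => ?_
  exact Real.sin_eq_zero_iff.1 ht

/-- Multiplication by `e^{-it}` makes the imaginary part `-sin t`, whatever `ρ` is. This controls
the logarithmic singularity uniformly as `ρ → 1`. -/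
theorem abs_sin_le_norm_one_sub_mul_exp (ρ t : ℝ) :
    |Real.sin t| ≤ ‖1 - (ρ : ℂ) * Complex.exp (Complex.I * t)‖ := by
  have h : ‖1 - (ρ : ℂ) * Complex.exp (Complex.I * t)‖
      = ‖Complex.exp (((-t : ℝ) : ℂ) * Complex.I) - ρ‖ := by
    rw [← one_mul ‖1 - (ρ : ℂ) * Complex.exp (Complex.I * t)‖,
      ← Complex.norm_exp_ofReal_mul_I (-t), ← norm_mul, mul_sub, mul_one, mul_left_comm,
      ← Complex.exp_add]
    simp [mul_comm]
  rw [h]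
  refine le_trans (le_of_eq ?_) (Complex.abs_im_le_norm _)
  rw [Complex.sub_im, Complex.exp_ofReal_mul_I_im]
  simp

/-- Abel summation: let `ρ → 1⁻` on both sides of the previous series, by dominated convergence for
the sum and for the integral. -/
theorem hasSum_sin_div_sq (θ : ℝ) :
    HasSum (fun n : ℕ => Real.sin (n * θ) / (n : ℝ) ^ 2) (clausenTwo θ) := by
  have hs : Summable fun n : ℕ => 1 / (n : ℝ) ^ 2 := Real.summable_one_div_nat_pow.2 one_lt_two
  have hb (n : ℕ) : ‖Real.sin (n * θ) / (n : ℝ) ^ 2‖ ≤ 1 / (n : ℝ) ^ 2 := by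
    rw [norm_div, norm_pow, Real.norm_natCast]
    gcongr
    exact Real.abs_sin_le_one _
  have hmem : ∀ᶠ ρ : ℝ in 𝓝[<] 1, 0 ≤ ρ ∧ ρ < 1 := by
    filter_upwards [Ioo_mem_nhdsLT (zero_lt_one (α := ℝ))] with ρ h using ⟨h.1.le, h.2⟩
  have hid : Tendsto (fun ρ : ℝ => ρ) (𝓝[<] 1) (𝓝 1) := tendsto_nhdsWithin_of_tendsto_nhds tendsto_id
  have l1 : Tendsto (fun ρ : ℝ => ∑' n : ℕ, ρ ^ n * (Real.sin (n * θ) / (n : ℝ) ^ 2)) (𝓝[<] 1)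
      (𝓝 (∑' n : ℕ, Real.sin (n * θ) / (n : ℝ) ^ 2)) := by
    refine tendsto_tsum_of_dominated_convergence hs (fun n => ?_) ?_
    · simpa using (hid.pow n).mul_const (Real.sin (n * θ) / (n : ℝ) ^ 2)
    · filter_upwards [hmem] with ρ h n
      rw [norm_mul, norm_pow, Real.norm_of_nonneg h.1]
      exact (mul_le_of_le_one_left (norm_nonneg _) (pow_le_one₀ h.1 h.2.le)).trans (hb n)
  have l2 : Tendsto (fun ρ : ℝ => ∫ t in (0 : ℝ)..θ,
      Real.log ‖1 - (ρ : ℂ) * Complex.exp (Complex.I * t)‖) (𝓝[<] 1)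
      (𝓝 (∫ t in (0 : ℝ)..θ, Real.log |2 * Real.sin (t / 2)|)) := by
    have hne : ∀ᵐ t : ℝ, Real.sin t ≠ 0 :=
      (countable_setOf_sin_eq_zero.ae_notMem volume)
    -- The integrand is the logarithm of a number between `|sin t|` and `2`, which gives the
    -- integrable majorant.
    refine intervalIntegral.tendsto_integral_filter_of_dominated_convergence
      (fun t => Real.log 2 + ‖(Real.log ∘ Real.sin) t‖) ?_ ?_ ?_ ?_
    · exact Eventually.of_forall fun ρ => (Measurable.aestronglyMeasurable (by fun_prop))
    · filter_upwards [hmem] with ρ h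
      filter_upwards [hne] with t ht _
      have h1 := abs_sin_le_norm_one_sub_mul_exp ρ t
      have h2 : ‖1 - (ρ : ℂ) * Complex.exp (Complex.I * t)‖ ≤ 2 := by
        refine (norm_sub_le _ _).trans ?_
        rw [norm_mul, Complex.norm_exp_I_mul_ofReal, mul_one, Complex.norm_real,
          Real.norm_of_nonneg h.1, norm_one]
        linarith [h.2]
      have h3 := abs_pos.2 ht
      have h4 := Real.log_le_log h3 h1
      have h5 := Real.log_le_log (h3.trans_le h1) h2
      have h6 := Real.log_nonpos h3.le (Real.abs_sin_le_one t)
      have h7 := Real.log_nonneg (one_le_two (α := ℝ))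
      rw [Function.comp_apply, Real.norm_eq_abs, Real.norm_eq_abs, ← Real.log_abs (Real.sin t),
        abs_of_nonpos h6]
      exact abs_le.2 ⟨by linarith, by linarith⟩
    · exact intervalIntegrable_const.add intervalIntegrable_log_sin.norm
    · filter_upwards [hne] with t ht _
      have h1 : ‖(1 : ℂ) - ((1 : ℝ) : ℂ) * Complex.exp (Complex.I * t)‖ = |2 * Real.sin (t / 2)| := by
        rw [norm_sub_rev]
        simpa using Complex.norm_exp_I_mul_ofReal_sub_one t
      have h2 : ‖(1 : ℂ) - ((1 : ℝ) : ℂ) * Complex.exp (Complex.I * t)‖ ≠ 0 :=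
        ((abs_pos.2 ht).trans_le (abs_sin_le_norm_one_sub_mul_exp 1 t)).ne'
      rw [← h1]
      refine Tendsto.log ?_ h2
      exact tendsto_nhdsWithin_of_tendsto_nhds (Continuous.tendsto
        (f := fun ρ : ℝ => ‖1 - (ρ : ℂ) * Complex.exp (Complex.I * t)‖) (by fun_prop) 1)
  have l3 : ∑' n : ℕ, Real.sin (n * θ) / (n : ℝ) ^ 2 = clausenTwo θ := by
    refine tendsto_nhds_unique l1 (l2.neg.congr' ?_)
    filter_upwards [hmem] with ρ h using (hasSum_pow_mul_sin_div_sq θ h.1 h.2).tsum_eq.symm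
  rw [← l3]
  exact (Summable.of_norm_bounded hs hb).hasSum

/-! ### Functional equations and the value at `π/3` -/

theorem clausenTwo_two_pi_sub (θ : ℝ) : clausenTwo (2 * Real.pi - θ) = -clausenTwo θ := by
  refine (hasSum_sin_div_sq _).unique ((hasSum_sin_div_sq θ).neg.congr_fun fun n => ?_)
  rw [mul_sub, Real.sin_nat_mul_two_pi_sub, neg_div]

/-- Shifting by `π` multiplies the `n`-th term by `(-1)ⁿ`, so only even `n` survive in the sum. -/
theorem clausenTwo_add_clausenTwo_add_pi (θ : ℝ) :
    clausenTwo θ + clausenTwo (θ + Real.pi) = clausenTwo (2 * θ) / 2 := by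
  have h := (hasSum_sin_div_sq θ).add (hasSum_sin_div_sq (θ + Real.pi))
  have hi : Function.Injective fun n : ℕ => 2 * n := fun a b h => by simpa using h
  refine ((hi.hasSum_iff ?_).2 h).unique (((hasSum_sin_div_sq (2 * θ)).div_const 2).congr_fun ?_)
  · intro n hn
    have ho : Odd n := by
      rw [← Nat.not_even_iff_odd]
      rintro ⟨k, rfl⟩
      exact hn ⟨k, by simp; ring⟩
    rw [mul_add, Real.sin_add_nat_mul_pi, ho.neg_one_pow]
    ring
  · intro n
    simp only [Function.comp_apply]
    rw [mul_add, Real.sin_add_nat_mul_pi, (even_two_mul n).neg_one_pow]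
    push_cast
    rw [show (2 * n : ℝ) * θ = n * (2 * θ) by ring]
    ring

theorem clausenTwo_pi_div_three :
    clausenTwo (Real.pi / 3) = 3 / 2 * clausenTwo (2 * Real.pi / 3) := by
  have h := clausenTwo_add_clausenTwo_add_pi (Real.pi / 3)
  have h2 := clausenTwo_two_pi_sub (2 * Real.pi / 3)
  rw [show 2 * Real.pi - 2 * Real.pi / 3 = Real.pi / 3 + Real.pi by ring] at h2
  rw [h2, show 2 * (Real.pi / 3) = 2 * Real.pi / 3 by ring] at h
  linarith

theorem im_dilog_exp (θ : ℝ) : (dilog (Complex.exp (Complex.I * θ))).im = clausenTwo θ := by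
  have hterm (n : ℕ) : Complex.exp (Complex.I * θ) ^ (n + 1) / ((n : ℂ) + 1) ^ 2
      = Complex.exp (((n + 1 : ℕ) * θ : ℝ) * Complex.I) / ((((n + 1 : ℕ) : ℝ) ^ 2 : ℝ) : ℂ) := by
    rw [← Complex.exp_nat_mul]
    push_cast
    congr 2
    ring
  have hs : Summable fun n : ℕ => Complex.exp (Complex.I * θ) ^ (n + 1) / ((n : ℂ) + 1) ^ 2 := by
    refine Summable.of_norm_bounded
      ((summable_nat_add_iff 1).2 (Real.summable_one_div_nat_pow.2 one_lt_two)) fun n => ?_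
    rw [hterm, norm_div, Complex.norm_exp_ofReal_mul_I, Complex.norm_real, norm_pow,
      Real.norm_natCast]
  have h := Complex.hasSum_im hs.hasSum
  have h' := (hasSum_nat_add_iff' 1).2 (hasSum_sin_div_sq θ)
  rw [Finset.sum_range_one, Nat.cast_zero, zero_mul, Real.sin_zero, zero_div, sub_zero] at h'
  refine h.unique (h'.congr_fun fun n => ?_)
  rw [hterm, Complex.div_ofReal_im, Complex.exp_ofReal_mul_I_im]

theorem tsum_eq_tsum_mod_three {f : ℕ → ℝ} (hf : Summable f) :
    ∑' n, f n = ∑' n, f (3 * n) + ∑' n, f (3 * n + 1) + ∑' n, f (3 * n + 2) := by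
  rw [Nat.sumByResidueClasses hf 3]
  have : ∀ g : ZMod 3 → ℝ, ∑ j, g j = g 0 + g 1 + g 2 := fun g => Fin.sum_univ_three g
  rw [this]
  have h0 : (0 : ZMod 3).val = 0 := rfl
  have h1 : (1 : ZMod 3).val = 1 := rfl
  have h2 : (2 : ZMod 3).val = 2 := rfl
  simp only [h0, h1, h2, add_comm, zero_add]

/-- `sin (2πn/3)` is `0`, `√3/2`, `-√3/2` according to `n` mod 3. -/
theorem clausenTwo_two_pi_div_three :
    clausenTwo (2 * Real.pi / 3) = √3 / 2 *
      (∑' n : ℕ, 1 / (3 * n + 1 : ℝ) ^ 2 - ∑' n : ℕ, 1 / (3 * n + 2 : ℝ) ^ 2) := by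
  have h := hasSum_sin_div_sq (2 * Real.pi / 3)
  rw [← h.tsum_eq, tsum_eq_tsum_mod_three h.summable, mul_sub, ← tsum_mul_left, ← tsum_mul_left,
    sub_eq_add_neg, ← tsum_neg]
  have e0 (n : ℕ) : Real.sin (((3 * n : ℕ) : ℝ) * (2 * Real.pi / 3)) = 0 := by
    rw [← Real.sin_zero, ← Real.sin_add_nat_mul_two_pi 0 n]
    push_cast; ring_nf
  have e1 (n : ℕ) : ((3 * n + 1 : ℕ) : ℝ) * (2 * Real.pi / 3)
      = (Real.pi - Real.pi / 3) + n * (2 * Real.pi) := by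
    push_cast; ring
  have e2 (n : ℕ) : ((3 * n + 2 : ℕ) : ℝ) * (2 * Real.pi / 3)
      = (Real.pi / 3 + Real.pi) + n * (2 * Real.pi) := by
    push_cast; ring
  simp only [e0, e1, e2, Real.sin_add_nat_mul_two_pi, zero_div, tsum_zero, zero_add,
    Real.sin_pi_sub, Real.sin_add_pi, Real.sin_pi_div_three]
  refine congrArg₂ _ (tsum_congr fun n => ?_) (tsum_congr fun n => ?_) <;> push_cast <;> ring

/-- This is `ζ(2)` without the multiples of three: `(1 - 1/9) π²/6`. -/
theorem tsum_one_div_sq_mod_three :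
    ∑' n : ℕ, 1 / (3 * n + 1 : ℝ) ^ 2 + ∑' n : ℕ, 1 / (3 * n + 2 : ℝ) ^ 2
      = 4 / 27 * Real.pi ^ 2 := by
  have h := tsum_eq_tsum_mod_three hasSum_zeta_two.summable
  have h0 : ∑' n : ℕ, 1 / ((3 * n : ℕ) : ℝ) ^ 2 = 1 / 9 * (Real.pi ^ 2 / 6) := by
    rw [← hasSum_zeta_two.tsum_eq, ← tsum_mul_left]
    refine tsum_congr fun n => ?_
    push_cast
    rw [mul_pow]
    ring
  rw [hasSum_zeta_two.tsum_eq, h0] at h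
  push_cast at h
  linarith

/-! ### The series of the trigamma function -/

theorem logDeriv_Gamma_eq_deriv {x : ℝ} (hx : 0 < x) :
    logDeriv Real.Gamma x = deriv (Real.log ∘ Real.Gamma) x := by
  have h1 : DifferentiableAt ℝ Real.Gamma x := Real.differentiableAt_Gamma fun m => by
    have : (0 : ℝ) ≤ m := m.cast_nonneg
    linarith
  rw [Function.comp_def, deriv.log h1 (Real.Gamma_pos_of_pos hx).ne', logDeriv_apply]

theorem logDeriv_Gamma_add_one {x : ℝ} (hx : 0 < x) :
    logDeriv Real.Gamma (x + 1) = logDeriv Real.Gamma x + 1 / x := by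
  have h1 : DifferentiableAt ℝ Real.Gamma x := Real.differentiableAt_Gamma fun m => by
    have : (0 : ℝ) ≤ m := m.cast_nonneg
    linarith
  have h2 : deriv Real.Gamma (x + 1) = Real.Gamma x + x * deriv Real.Gamma x := by
    rw [← deriv_comp_add_const]
    have h3 : (fun y => Real.Gamma (y + 1)) =ᶠ[𝓝 x] fun y => y * Real.Gamma y := by
      filter_upwards [eventually_gt_nhds hx] with y hy using Real.Gamma_add_one hy.ne'
    rw [h3.deriv_eq, deriv_fun_mul differentiableAt_fun_id h1]
    simp
  have h4 := (Real.Gamma_pos_of_pos hx).ne'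
  rw [logDeriv_apply, logDeriv_apply, h2, Real.Gamma_add_one hx.ne']
  field_simp
  ring

/-- Log-convexity of `Γ`; it takes the place of asymptotics for the digamma function. -/
theorem monotoneOn_logDeriv_Gamma : MonotoneOn (logDeriv Real.Gamma) (Set.Ioi 0) := by
  have h := Real.convexOn_log_Gamma.monotoneOn_deriv fun x (hx : 0 < x) =>
    (Real.differentiableAt_Gamma fun m => by
      have : (0 : ℝ) ≤ m := m.cast_nonneg
      linarith).log (Real.Gamma_pos_of_pos hx).ne'
  exact h.congr fun x hx => (logDeriv_Gamma_eq_deriv hx).symm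

theorem logDeriv_Gamma_add_nat {x : ℝ} (hx : 0 < x) (n : ℕ) :
    logDeriv Real.Gamma (x + n) = logDeriv Real.Gamma x + ∑ k ∈ Finset.range n, 1 / (x + k) := by
  induction n with
  | zero => simp
  | succ n ih =>
    rw [Finset.sum_range_succ, Nat.cast_succ, ← add_assoc, logDeriv_Gamma_add_one (by positivity),
      ih, add_assoc]

/-- The recurrence telescopes the partial sums. Writing `ψ = Γ'/Γ`, monotonicity and `ψ(n + 1) =
ψ(n) + 1/n` squeeze the remainder `ψ(1 + n) - ψ(x + n)` between `0` and `1/n`. -/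
theorem hasSum_logDeriv_Gamma {x : ℝ} (hx : 0 < x) (hx1 : x ≤ 1) :
    HasSum (fun n : ℕ => 1 / (x + n) - 1 / (1 + n))
      (logDeriv Real.Gamma 1 - logDeriv Real.Gamma x) := by
  rw [hasSum_iff_tendsto_nat_of_nonneg fun n =>
    sub_nonneg.2 (one_div_le_one_div_of_le (by positivity) (by linarith))]
  have e (n : ℕ) : ∑ k ∈ Finset.range n, (1 / (x + k) - 1 / (1 + k))
      = (logDeriv Real.Gamma 1 - logDeriv Real.Gamma x)
        - (logDeriv Real.Gamma (1 + n) - logDeriv Real.Gamma (x + n)) := by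
    rw [Finset.sum_sub_distrib, logDeriv_Gamma_add_nat hx, logDeriv_Gamma_add_nat one_pos]
    ring
  simp only [e]
  have lim : Tendsto (fun n : ℕ => logDeriv Real.Gamma (1 + n) - logDeriv Real.Gamma (x + n))
      atTop (𝓝 0) := by
    refine tendsto_of_tendsto_of_tendsto_of_le_of_le' tendsto_const_nhds
      tendsto_one_div_atTop_nhds_zero_nat ?_ ?_
    · refine Eventually.of_forall fun n => sub_nonneg.2 (monotoneOn_logDeriv_Gamma ?_ ?_ ?_)
      · exact Set.mem_Ioi.2 (by positivity)
      · exact Set.mem_Ioi.2 (by positivity)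
      · linarith
    · filter_upwards [eventually_gt_atTop 0] with n hn
      have hn' : (0 : ℝ) < n := by exact_mod_cast hn
      have h := monotoneOn_logDeriv_Gamma (a := (n : ℝ)) (b := x + n) hn'
        (Set.mem_Ioi.2 (by positivity)) (by linarith)
      rw [add_comm 1, logDeriv_Gamma_add_one hn']
      linarith
  simpa using tendsto_const_nhds.sub lim

theorem trigamma_eq_tsum {x : ℝ} (hx : 0 < x) (hx1 : x < 1) :
    trigamma x = ∑' n : ℕ, 1 / (x + n) ^ 2 := by
  -- Staying to the right of `x / 2` provides one summable majorant for all differentiated terms.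
  set t := Set.Ioo (x / 2) 1
  have hxt : x ∈ t := ⟨by linarith, hx1⟩
  have hpos {y : ℝ} (hy : y ∈ t) (n : ℕ) : 0 < x / 2 + n ∧ x / 2 + n ≤ y + n :=
    ⟨by positivity, by linarith [hy.1]⟩
  have hu : Summable fun n : ℕ => 1 / (x / 2 + n) ^ 2 := by
    have := (Real.summable_one_div_nat_add_rpow (x / 2) 2).2 one_lt_two
    refine this.congr fun n => ?_
    rw [abs_of_pos (by positivity), Real.rpow_two, add_comm]
  have h := hasDerivAt_tsum_of_isPreconnected (g := fun (n : ℕ) (y : ℝ) => 1 / (y + n) - 1 / (1 + n))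
    (g' := fun (n : ℕ) (y : ℝ) => -(1 / (y + n) ^ 2)) hu isOpen_Ioo isPreconnected_Ioo
    (fun n y hy => ?_) (fun n y hy => ?_) hxt (hasSum_logDeriv_Gamma hx hx1.le).summable hxt
  · have heq : (fun y => ∑' n : ℕ, (1 / (y + n) - 1 / (1 + n)))
        =ᶠ[𝓝 x] fun y => logDeriv Real.Gamma 1 - logDeriv Real.Gamma y := by
      filter_upwards [isOpen_Ioo.mem_nhds hxt] with y hy
      exact (hasSum_logDeriv_Gamma (by linarith [hy.1]) hy.2.le).tsum_eq
    have h2 := (h.congr_of_eventuallyEq heq.symm).const_sub (logDeriv Real.Gamma 1)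
    simp only [sub_sub_cancel] at h2
    rw [trigamma, h2.deriv, tsum_neg, neg_neg]
  · have := (hpos hy n).1.trans_le (hpos hy n).2
    have h1 := (((hasDerivAt_id y).add_const (n : ℝ)).inv this.ne').sub_const (1 / (1 + n : ℝ))
    simpa [one_div, neg_div] using h1
  · have := (hpos hy n).1
    have := (hpos hy n).2
    rw [norm_neg, Real.norm_of_nonneg (by positivity)]
    gcongr

theorem clausenTwo_pi_div_three_eq_tsum :
    clausenTwo (Real.pi / 3) = 3 * √3 / 4 *
      (∑' n : ℕ, 1 / (3 * n + 1 : ℝ) ^ 2 - ∑' n : ℕ, 1 / (3 * n + 2 : ℝ) ^ 2) := by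
  rw [clausenTwo_pi_div_three, clausenTwo_two_pi_div_three]
  ring

theorem clausenTwo_pi_div_three_eq_trigamma :
    clausenTwo (Real.pi / 3) = √3 / 6 * (trigamma (1 / 3) - 2 / 3 * Real.pi ^ 2) := by
  have h : trigamma (1 / 3) = 9 * ∑' n : ℕ, 1 / (3 * n + 1 : ℝ) ^ 2 := by
    rw [trigamma_eq_tsum (by norm_num) (by norm_num), ← tsum_mul_left]
    refine tsum_congr fun n => ?_
    field_simp
    ring
  have h2 := tsum_one_div_sq_mod_three
  rw [clausenTwo_pi_div_three_eq_tsum, h, eq_sub_of_add_eq' h2]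
  ring

/-! ### Numerical bounds by Euler-Maclaurin -/

/-- The Euler-Maclaurin approximation from above to `∑ 1 / (x + n) ^ 2`. -/
noncomputable def eulerMaclaurinUpper (x : ℝ) : ℝ :=
  1 / x + 1 / (2 * x ^ 2) + 1 / (6 * x ^ 3) - 1 / (30 * x ^ 5) + 1 / (42 * x ^ 7)
    - 1 / (30 * x ^ 9) + 5 / (66 * x ^ 11)

/-- The Euler-Maclaurin approximation from below to `∑ 1 / (x + n) ^ 2`. -/
noncomputable def eulerMaclaurinLower (x : ℝ) : ℝ :=
  eulerMaclaurinUpper x - 691 / (2730 * x ^ 13)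

/-- The excess is a rational function whose numerator has only positive coefficients. Summing this
telescoping inequality bounds the series with no analysis of a remainder term. -/
theorem one_div_sq_le_eulerMaclaurinUpper {x : ℝ} (hx : 0 < x) :
    1 / x ^ 2 ≤ eulerMaclaurinUpper x - eulerMaclaurinUpper (x + 1) := by
  have h : eulerMaclaurinUpper x - eulerMaclaurinUpper (x + 1) - 1 / x ^ 2
      = (175 + 1925 * x ^ 1 + 9548 * x ^ 2 + 28028 * x ^ 3 + 53570 * x ^ 4 + 68750 * x ^ 5 + 58388 * x ^ 6 + 30404 * x ^ 7 + 7601 * x ^ 8)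
        / (2310 * x ^ 11 * (x + 1) ^ 11) := by
    unfold eulerMaclaurinUpper
    field_simp
    ring
  have h2 : 0 ≤ eulerMaclaurinUpper x - eulerMaclaurinUpper (x + 1) - 1 / x ^ 2 := by
    rw [h]
    positivity
  linarith

theorem eulerMaclaurinLower_le_one_div_sq {x : ℝ} (hx : 0 < x) :
    eulerMaclaurinLower x - eulerMaclaurinLower (x + 1) ≤ 1 / x ^ 2 := by
  have h : 1 / x ^ 2 - (eulerMaclaurinLower x - eulerMaclaurinLower (x + 1))
      = (7601 + 98813 * x ^ 1 + 590603 * x ^ 2 + 2144311 * x ^ 3 + 5258266 * x ^ 4 + 9144850 * x ^ 5 + 11494054 * x ^ 6 + 10392382 * x ^ 7 + 6539533 * x ^ 8 + 2627625 * x ^ 9 + 525525 * x ^ 10)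
        / (30030 * x ^ 13 * (x + 1) ^ 13) := by
    unfold eulerMaclaurinLower eulerMaclaurinUpper
    field_simp
    ring
  have h2 : 0 ≤ 1 / x ^ 2 - (eulerMaclaurinLower x - eulerMaclaurinLower (x + 1)) := by
    rw [h]
    positivity
  linarith

theorem tendsto_eulerMaclaurinUpper : Tendsto eulerMaclaurinUpper atTop (𝓝 0) := by
  have h (c d : ℝ) (hd : 0 < d) (k : ℕ) : Tendsto (fun x : ℝ => c / (d * x ^ (k + 1))) atTop (𝓝 0) :=
    tendsto_const_nhds.div_atTop ((tendsto_pow_atTop k.succ_ne_zero).const_mul_atTop hd)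
  have := ((((((h 1 1 one_pos 0).add (h 1 2 two_pos 1)).add (h 1 6 (by norm_num) 2)).sub
    (h 1 30 (by norm_num) 4)).add (h 1 42 (by norm_num) 6)).sub (h 1 30 (by norm_num) 8)).add
    (h 5 66 (by norm_num) 10)
  simp only [add_zero, sub_zero, zero_add, pow_one, one_mul, Nat.reduceAdd] at this
  exact this

theorem tendsto_eulerMaclaurinLower : Tendsto eulerMaclaurinLower atTop (𝓝 0) := by
  have : Tendsto (fun x : ℝ => 691 / (2730 * x ^ 13)) atTop (𝓝 0) :=
    tendsto_const_nhds.div_atTop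
      ((tendsto_pow_atTop (by norm_num)).const_mul_atTop (by norm_num))
  have h := tendsto_eulerMaclaurinUpper.sub this
  rw [sub_zero] at h
  exact h

theorem sum_range_sub_add_one (F : ℝ → ℝ) (x : ℝ) (N : ℕ) :
    ∑ n ∈ Finset.range N, (F (x + n) - F (x + n + 1)) = F x - F (x + N) := by
  induction N with
  | zero => simp
  | succ N ih => rw [Finset.sum_range_succ, ih]; push_cast; rw [add_assoc x]; ring

theorem tendsto_sub_add_nat {F : ℝ → ℝ} (hF : Tendsto F atTop (𝓝 0)) (x : ℝ) :
    Tendsto (fun N : ℕ => F x - F (x + N)) atTop (𝓝 (F x)) := by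
  simpa using (tendsto_const_nhds (x := F x)).sub
    (hF.comp (tendsto_atTop_add_const_left _ x tendsto_natCast_atTop_atTop))

theorem summable_one_div_add_sq {x : ℝ} (hx : 0 < x) : Summable fun n : ℕ => 1 / (x + n) ^ 2 := by
  refine ((Real.summable_one_div_nat_add_rpow x 2).2 one_lt_two).congr fun n => ?_
  rw [abs_of_pos (by positivity), Real.rpow_two, add_comm]

theorem tsum_one_div_add_sq_le {x : ℝ} (hx : 0 < x) :
    ∑' n : ℕ, 1 / (x + n) ^ 2 ≤ eulerMaclaurinUpper x := by
  refine le_of_tendsto_of_tendsto' (summable_one_div_add_sq hx).hasSum.tendsto_sum_nat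
    (tendsto_sub_add_nat tendsto_eulerMaclaurinUpper x) fun N => ?_
  rw [← sum_range_sub_add_one]
  exact Finset.sum_le_sum fun n _ => one_div_sq_le_eulerMaclaurinUpper (by positivity)

theorem le_tsum_one_div_add_sq {x : ℝ} (hx : 0 < x) :
    eulerMaclaurinLower x ≤ ∑' n : ℕ, 1 / (x + n) ^ 2 := by
  refine le_of_tendsto_of_tendsto' (tendsto_sub_add_nat tendsto_eulerMaclaurinLower x)
    (summable_one_div_add_sq hx).hasSum.tendsto_sum_nat fun N => ?_
  rw [← sum_range_sub_add_one]
  exact Finset.sum_le_sum fun n _ => eulerMaclaurinLower_le_one_div_sq (by positivity)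

theorem tsum_one_div_add_sq_bounds {x : ℝ} (hx : 0 < x) (N : ℕ) :
    ∑ n ∈ Finset.range N, 1 / (x + n) ^ 2 + eulerMaclaurinLower (x + N)
        ≤ ∑' n : ℕ, 1 / (x + n) ^ 2 ∧
      ∑' n : ℕ, 1 / (x + n) ^ 2
        ≤ ∑ n ∈ Finset.range N, 1 / (x + n) ^ 2 + eulerMaclaurinUpper (x + N) := by
  have hxN : 0 < x + N := by positivity
  have h := (summable_one_div_add_sq hx).sum_add_tsum_nat_add N
  have e (n : ℕ) : x + ((n + N : ℕ) : ℝ) = x + N + n := by push_cast; ring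
  simp only [e] at h
  rw [← h]
  exact ⟨by linarith [le_tsum_one_div_add_sq hxN], by linarith [tsum_one_div_add_sq_le hxN]⟩

theorem tsum_one_div_one_third_bounds :
    (100955971254270940817919 : ℝ) / 10 ^ 22 ≤ ∑' n : ℕ, 1 / (1 / 3 + n : ℝ) ^ 2 ∧
      ∑' n : ℕ, 1 / (1 / 3 + n : ℝ) ^ 2 ≤ 100955971254270940817980 / 10 ^ 22 := by
  -- After 32 explicit terms the two bounds differ by `691 / (2730 x¹³)` at `x = 32 + 1/3`, about `6
  -- · 10⁻²¹`.
  have h := tsum_one_div_add_sq_bounds (x := 1 / 3) (by norm_num) 32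
  refine ⟨le_trans ?_ h.1, h.2.trans ?_⟩ <;>
    norm_num [Finset.sum_range_succ, eulerMaclaurinLower, eulerMaclaurinUpper]

theorem tsum_one_div_two_thirds_bounds :
    (30638754093587174099872 : ℝ) / 10 ^ 22 ≤ ∑' n : ℕ, 1 / (2 / 3 + n : ℝ) ^ 2 ∧
      ∑' n : ℕ, 1 / (2 / 3 + n : ℝ) ^ 2 ≤ 30638754093587174099926 / 10 ^ 22 := by
  have h := tsum_one_div_add_sq_bounds (x := 2 / 3) (by norm_num) 32
  refine ⟨le_trans ?_ h.1, h.2.trans ?_⟩ <;>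
    norm_num [Finset.sum_range_succ, eulerMaclaurinLower, eulerMaclaurinUpper]

theorem abs_clausenTwo_pi_div_three_sub_lt :
    |clausenTwo (Real.pi / 3) - 1.0149416064096536250| < 5 / 10 ^ 20 := by
  have h : clausenTwo (Real.pi / 3) = √3 *
      (∑' n : ℕ, 1 / (1 / 3 + n : ℝ) ^ 2 - ∑' n : ℕ, 1 / (2 / 3 + n : ℝ) ^ 2) / 12 := by
    have h1 : ∑' n : ℕ, 1 / (1 / 3 + n : ℝ) ^ 2 = 9 * ∑' n : ℕ, 1 / (3 * n + 1 : ℝ) ^ 2 := by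
      rw [← tsum_mul_left]
      refine tsum_congr fun n => ?_
      field_simp
      ring
    have h2 : ∑' n : ℕ, 1 / (2 / 3 + n : ℝ) ^ 2 = 9 * ∑' n : ℕ, 1 / (3 * n + 2 : ℝ) ^ 2 := by
      rw [← tsum_mul_left]
      refine tsum_congr fun n => ?_
      field_simp
      ring
    rw [clausenTwo_pi_div_three_eq_tsum, h1, h2]
    ring
  obtain ⟨h1, h2⟩ := tsum_one_div_one_third_bounds
  obtain ⟨h3, h4⟩ := tsum_one_div_two_thirds_bounds
  have s1 : (17320508075688772935274 : ℝ) / 10 ^ 22 ≤ √3 := Real.le_sqrt_of_sq_le (by norm_num)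
  have s2 : √3 ≤ (17320508075688772935275 : ℝ) / 10 ^ 22 := Real.sqrt_le_iff.2 ⟨by norm_num, by norm_num⟩
  have d1 := sub_le_sub h1 h4
  have d2 := sub_le_sub h2 h3
  have l := mul_le_mul s1 d1 (by norm_num) (Real.sqrt_nonneg 3)
  have u := mul_le_mul s2 d2 (le_trans (by norm_num) d1) (by norm_num)
  rw [h, abs_lt, lt_sub_iff_add_lt, sub_lt_iff_lt_add, lt_div_iff₀ (by norm_num),
    div_lt_iff₀ (by norm_num)]
  exact ⟨lt_of_lt_of_le (by norm_num) l, u.trans_lt (by norm_num)⟩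

/-! ### The octant integral as a Clausen value -/

theorem lintegral_Ioi_of_hasDerivAt_of_nonneg {g g' : ℝ → ℝ} {a l : ℝ}
    (hderiv : ∀ x ∈ Set.Ici a, HasDerivAt g (g' x) x) (hpos : ∀ x ∈ Set.Ioi a, 0 ≤ g' x)
    (hg : Tendsto g atTop (𝓝 l)) :
    ∫⁻ x in Set.Ioi a, ENNReal.ofReal (g' x) = ENNReal.ofReal (l - g a) := by
  rw [← integral_Ioi_of_hasDerivAt_of_nonneg' hderiv hpos hg, ofReal_integral_eq_lintegral_ofReal
    (integrableOn_Ioi_deriv_of_nonneg' hderiv hpos hg)]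
  exact (ae_restrict_iff' measurableSet_Ioi).2 (Eventually.of_forall hpos)

theorem lintegral_Ioi_one_div_sq {A B : ℝ} (hA : 0 < A) (hB : 0 < B) :
    ∫⁻ z in Set.Ioi (0 : ℝ), ENNReal.ofReal (1 / (A + B * z) ^ 2)
      = ENNReal.ofReal (1 / (A * B)) := by
  have hpos {z : ℝ} (hz : 0 ≤ z) : 0 < A + B * z := by positivity
  have h := lintegral_Ioi_of_hasDerivAt_of_nonneg (a := 0) (l := 0)
    (g := fun z => -(A + B * z)⁻¹ / B) (g' := fun z => 1 / (A + B * z) ^ 2)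
    (fun z hz => ?_) (fun z _ => by positivity) ?_
  · rw [h]
    congr 1
    field_simp
    simp
  · have := (((((hasDerivAt_id z).const_mul B).const_add A).inv (hpos hz).ne').neg.div_const B)
    refine this.congr_deriv ?_
    have := (hpos hz).ne'
    simp only [id]
    field_simp
  · have : Tendsto (fun z : ℝ => A + B * z) atTop atTop :=
      tendsto_atTop_add_const_left _ _ (tendsto_id.const_mul_atTop hB)
    simpa using (tendsto_inv_atTop_zero.comp this).neg.div_const B

/-- Partial fractions; the determinant of the two linear factors in `y` is `(x + 1)² - x = x² + x +
1`. -/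
theorem lintegral_Ioi_one_div_mul {x : ℝ} (hx : 0 < x) :
    ∫⁻ y in Set.Ioi (0 : ℝ), ENNReal.ofReal (1 / ((x + (x + 1) * y) * (x + 1 + y)))
      = ENNReal.ofReal ((2 * Real.log (x + 1) - Real.log x) / (x ^ 2 + x + 1)) := by
  have h1 {y : ℝ} (hy : 0 ≤ y) : 0 < x + (x + 1) * y := by positivity
  have h2 {y : ℝ} (hy : 0 ≤ y) : 0 < x + 1 + y := by positivity
  have h3 : 0 < x ^ 2 + x + 1 := by positivity
  have h := lintegral_Ioi_of_hasDerivAt_of_nonneg (a := 0)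
    (l := Real.log (x + 1) / (x ^ 2 + x + 1))
    (g := fun y => (Real.log (x + (x + 1) * y) - Real.log (x + 1 + y)) / (x ^ 2 + x + 1))
    (g' := fun y => 1 / ((x + (x + 1) * y) * (x + 1 + y)))
    (fun y hy => ?_) (fun y hy => ?_) ?_
  · rw [h]
    simp only [mul_zero, add_zero]
    congr 1
    ring
  · have := (((((hasDerivAt_id y).const_mul (x + 1)).const_add x).log (h1 hy).ne').sub
      (((hasDerivAt_id y).const_add (x + 1)).log (h2 hy).ne')).div_const (x ^ 2 + x + 1)
    refine this.congr_deriv ?_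
    have := (h1 hy).ne'
    have := (h2 hy).ne'
    simp only [id]
    field_simp
    ring
  · have := h1 (le_of_lt hy)
    have := h2 (le_of_lt hy)
    positivity
  · refine Tendsto.div_const ?_ _
    have lim : Tendsto (fun y : ℝ => x + 1 - (x ^ 2 + x + 1) / (x + 1 + y)) atTop (𝓝 (x + 1)) := by
      simpa using tendsto_const_nhds.sub ((tendsto_const_nhds (x := x ^ 2 + x + 1)).div_atTop
        (tendsto_atTop_add_const_left _ (x + 1) tendsto_id))
    refine (lim.log (by positivity)).congr' ?_
    filter_upwards [eventually_ge_atTop 0] with y hy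
    have := (h1 hy).ne'
    have := (h2 hy).ne'
    rw [← Real.log_div (h1 hy).ne' (h2 hy).ne']
    congr 1
    field_simp
    ring

theorem intervalIntegrable_log_two_mul_sin (c d a b : ℝ) :
    IntervalIntegrable (fun t => Real.log |2 * Real.sin ((c * t + d) / 2)|) volume a b := by
  have : MeromorphicOn (fun t : ℝ => 2 * Real.sin ((c * t + d) / 2)) (Set.uIcc a b) := by
    intro t _
    have : AnalyticAt ℝ (fun t : ℝ => 2 * Real.sin ((c * t + d) / 2)) t := by fun_prop
    exact this.meromorphicAt
  simpa using this.intervalIntegrable_log_norm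

theorem integral_log_two_mul_sin {c : ℝ} (hc : c ≠ 0) (d a b : ℝ) :
    ∫ t in a..b, Real.log |2 * Real.sin ((c * t + d) / 2)|
      = c⁻¹ * (clausenTwo (c * a + d) - clausenTwo (c * b + d)) := by
  have h (u : ℝ) : IntervalIntegrable (fun t => Real.log |2 * Real.sin (t / 2)|) volume 0 u := by
    simpa using intervalIntegrable_log_two_mul_sin 1 0 0 u
  rw [intervalIntegral.integral_comp_mul_add (fun t => Real.log |2 * Real.sin (t / 2)|) hc,
    ← intervalIntegral.integral_interval_sub_left (h _) (h _), clausenTwo, clausenTwo, smul_eq_mul]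
  ring

/-- The volume density of the regular ideal tetrahedron in terms of an angle. -/
noncomputable def idealDensity (t : ℝ) : ℝ :=
  2 * Real.log |2 * Real.sin ((2 * t + 2 * Real.pi / 3) / 2)|
    - Real.log |2 * Real.sin ((2 * t + 0) / 2)|
    - Real.log |2 * Real.sin ((-2 * t + 2 * Real.pi / 3) / 2)|

theorem intervalIntegrable_idealDensity (a b : ℝ) :
    IntervalIntegrable idealDensity volume a b :=
  (((intervalIntegrable_log_two_mul_sin _ _ a b).const_mul 2).sub
    (intervalIntegrable_log_two_mul_sin _ _ a b)).sub (intervalIntegrable_log_two_mul_sin _ _ a b)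

theorem clausenTwo_zero : clausenTwo 0 = 0 := by
  simp [clausenTwo]

/-- The three pieces contribute `2`, `1/2` and `1/2` times `Cl₂(2π/3)`, by reflection at `4π/3`;
then `3 Cl₂(2π/3) = 2 Cl₂(π/3)`. -/
theorem integral_idealDensity :
    ∫ t in (0 : ℝ)..Real.pi / 3, idealDensity t = 2 * clausenTwo (Real.pi / 3) := by
  have h := intervalIntegrable_log_two_mul_sin
  unfold idealDensity
  rw [intervalIntegral.integral_sub (((h _ _ _ _).const_mul 2).sub (h _ _ _ _)) (h _ _ _ _),
    intervalIntegral.integral_sub ((h _ _ _ _).const_mul 2) (h _ _ _ _),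
    intervalIntegral.integral_const_mul, integral_log_two_mul_sin two_ne_zero,
    integral_log_two_mul_sin two_ne_zero, integral_log_two_mul_sin (by norm_num),
    clausenTwo_pi_div_three]
  have h1 := clausenTwo_two_pi_sub (2 * Real.pi / 3)
  rw [show 2 * Real.pi - 2 * Real.pi / 3 = 2 * (Real.pi / 3) + 2 * Real.pi / 3 by ring] at h1
  rw [h1, show 2 * 0 + 2 * Real.pi / 3 = 2 * Real.pi / 3 by ring,
    show 2 * (Real.pi / 3) + 0 = 2 * Real.pi / 3 by ring,
    show -2 * (Real.pi / 3) + 2 * Real.pi / 3 = 0 by ring,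
    show -2 * 0 + 2 * Real.pi / 3 = 2 * Real.pi / 3 by ring, mul_zero, add_zero, clausenTwo_zero]
  ring

/-- The change of variables between the angle `t` and the ratio of two sides of a triangle with
angles `t`, `π / 3 - t` and `2 * π / 3`. -/
noncomputable def sineRatio (t : ℝ) : ℝ :=
  Real.sin t / Real.sin (Real.pi / 3 - t)

theorem sin_pos_of_mem_Ioo {t : ℝ} (ht : t ∈ Set.Ioo 0 (Real.pi / 3)) :
    0 < Real.sin t ∧ 0 < Real.sin (Real.pi / 3 - t) ∧ 0 < Real.sin (t + Real.pi / 3) := by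
  have := Real.pi_pos
  exact ⟨Real.sin_pos_of_pos_of_lt_pi ht.1 (by linarith [ht.2]),
    Real.sin_pos_of_pos_of_lt_pi (by linarith [ht.2]) (by linarith [ht.1]),
    Real.sin_pos_of_pos_of_lt_pi (by linarith [ht.1]) (by linarith [ht.2])⟩

theorem hasDerivAt_sineRatio {t : ℝ} (ht : t ∈ Set.Ioo 0 (Real.pi / 3)) :
    HasDerivAt sineRatio (√3 / 2 / Real.sin (Real.pi / 3 - t) ^ 2) t := by
  have h := (sin_pos_of_mem_Ioo ht).2.1
  have h1 := (Real.hasDerivAt_sin t).div ((Real.hasDerivAt_sin (Real.pi / 3 - t)).comp t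
    ((hasDerivAt_id t).const_sub (Real.pi / 3))) h.ne'
  refine h1.congr_deriv ?_
  congr 1
  have h2 := Real.sin_add t (Real.pi / 3 - t)
  rw [add_sub_cancel, Real.sin_pi_div_three] at h2
  rw [h2]
  simp
  ring

theorem sineRatio_image : sineRatio '' Set.Ioo 0 (Real.pi / 3) = Set.Ioi 0 := by
  ext x
  constructor
  · rintro ⟨t, ht, rfl⟩
    exact div_pos (sin_pos_of_mem_Ioo ht).1 (sin_pos_of_mem_Ioo ht).2.1
  · intro hx
    have hx : 0 < x := hx
    have h3 : (0 : ℝ) < √3 := by positivity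
    have hs : √3 ^ 2 = 3 := Real.sq_sqrt (by norm_num)
    -- Solves `sin t = x sin (π/3 - t)` for `tan t`.
    set t := Real.arctan (√3 * x / (2 + x))
    have ht0 : 0 < t := Real.arctan_pos.2 (by positivity)
    have ht1 : t < Real.pi / 3 := by
      rw [← Real.arctan_sqrt_three]
      refine Real.arctan_strictMono ?_
      rw [div_lt_iff₀ (by positivity)]
      nlinarith
    refine ⟨t, ⟨ht0, ht1⟩, ?_⟩
    have hc : 0 < Real.cos t := Real.cos_arctan_pos _
    have htan : Real.sin t = √3 * x / (2 + x) * Real.cos t := by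
      rw [← Real.tan_arctan (√3 * x / (2 + x)), Real.tan_eq_sin_div_cos]
      field_simp
      rfl
    rw [sineRatio, div_eq_iff (sin_pos_of_mem_Ioo ⟨ht0, ht1⟩).2.1.ne', Real.sin_sub,
      Real.sin_pi_div_three, Real.cos_pi_div_three, htan]
    field_simp
    ring

theorem injOn_sineRatio : Set.InjOn sineRatio (Set.Ioo 0 (Real.pi / 3)) := by
  refine StrictMonoOn.injOn (strictMonoOn_of_deriv_pos (convex_Ioo _ _)
    (fun t ht => (hasDerivAt_sineRatio ht).continuousAt.continuousWithinAt) fun t ht => ?_)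
  rw [interior_Ioo] at ht
  rw [(hasDerivAt_sineRatio ht).deriv]
  have := (sin_pos_of_mem_Ioo ht).2.1
  positivity

/-- With `S = sin (π/3 - t)` and `x = sineRatio t`, the law of cosines reads `x² + x + 1 = 3 / (4
S²)`, so the Jacobian `√3 / (2 S²)` cancels the denominator. Only logarithms of sines remain, and
their `log 2` terms cancel. -/
theorem deriv_mul_sineRatio {t : ℝ} (ht : t ∈ Set.Ioo 0 (Real.pi / 3)) :
    √3 / 2 / Real.sin (Real.pi / 3 - t) ^ 2 *
        ((2 * Real.log (sineRatio t + 1) - Real.log (sineRatio t))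
          / (sineRatio t ^ 2 + sineRatio t + 1))
      = 2 * √3 / 3 * idealDensity t := by
  obtain ⟨h1, h2, h3⟩ := sin_pos_of_mem_Ioo ht
  have hs : √3 ^ 2 = 3 := Real.sq_sqrt (by norm_num)
  have e1 : sineRatio t + 1 = Real.sin (t + Real.pi / 3) / Real.sin (Real.pi / 3 - t) := by
    rw [sineRatio, div_add_one h2.ne', Real.sin_sub, Real.sin_add, Real.sin_pi_div_three,
      Real.cos_pi_div_three]
    congr 1
    ring
  have e2 : sineRatio t ^ 2 + sineRatio t + 1 = 3 / 4 / Real.sin (Real.pi / 3 - t) ^ 2 := by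
    have hS : Real.sin (Real.pi / 3 - t) = √3 / 2 * Real.cos t - 1 / 2 * Real.sin t := by
      rw [Real.sin_sub, Real.sin_pi_div_three, Real.cos_pi_div_three]
    rw [eq_div_iff (by positivity), sineRatio]
    generalize Real.sin (Real.pi / 3 - t) = S at h2 hS
    field_simp
    have := Real.sin_sq_add_cos_sq t
    rw [hS]
    linear_combination 3 * this + Real.cos t ^ 2 * hs
  have e3 : idealDensity t = 2 * Real.log (Real.sin (t + Real.pi / 3)) - Real.log (Real.sin t)
      - Real.log (Real.sin (Real.pi / 3 - t)) := by
    rw [idealDensity, show (2 * t + 2 * Real.pi / 3) / 2 = t + Real.pi / 3 by ring,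
      show (2 * t + 0) / 2 = t by ring, show (-2 * t + 2 * Real.pi / 3) / 2 = Real.pi / 3 - t by ring]
    simp only [Real.log_abs]
    rw [Real.log_mul two_ne_zero h1.ne', Real.log_mul two_ne_zero h2.ne',
      Real.log_mul two_ne_zero h3.ne']
    ring
  rw [e1, e2, e3, sineRatio, Real.log_div h3.ne' h2.ne', Real.log_div h1.ne' h2.ne']
  generalize Real.sin (Real.pi / 3 - t) = S at h2
  field_simp
  ring

theorem lintegral_Ioi_log :
    ∫⁻ x in Set.Ioi (0 : ℝ),
        ENNReal.ofReal ((2 * Real.log (x + 1) - Real.log x) / (x ^ 2 + x + 1))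
      = ENNReal.ofReal (4 * √3 / 3 * clausenTwo (Real.pi / 3)) := by
  have hnn {x : ℝ} (hx : 0 < x) :
      0 ≤ (2 * Real.log (x + 1) - Real.log x) / (x ^ 2 + x + 1) := by
    have h1 := Real.log_le_log hx (by linarith : x ≤ x + 1)
    have h2 := Real.log_nonneg (by linarith : 1 ≤ x + 1)
    exact div_nonneg (by linarith) (by positivity)
  have hpos {t : ℝ} (ht : t ∈ Set.Ioo 0 (Real.pi / 3)) : 0 < sineRatio t :=
    div_pos (sin_pos_of_mem_Ioo ht).1 (sin_pos_of_mem_Ioo ht).2.1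
  have hpi : (0 : ℝ) ≤ Real.pi / 3 := by positivity
  rw [← sineRatio_image, lintegral_image_eq_lintegral_abs_deriv_mul measurableSet_Ioo
    (fun t ht => (hasDerivAt_sineRatio ht).hasDerivWithinAt) injOn_sineRatio]
  have hint := ((intervalIntegrable_iff_integrableOn_Ioo_of_le hpi).1
    (intervalIntegrable_idealDensity 0 (Real.pi / 3))).const_mul (2 * √3 / 3)
  have heq : ∀ t ∈ Set.Ioo 0 (Real.pi / 3),
      ENNReal.ofReal |√3 / 2 / Real.sin (Real.pi / 3 - t) ^ 2| *
        ENNReal.ofReal ((2 * Real.log (sineRatio t + 1) - Real.log (sineRatio t))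
          / (sineRatio t ^ 2 + sineRatio t + 1)) = ENNReal.ofReal (2 * √3 / 3 * idealDensity t) := by
    intro t ht
    rw [← ENNReal.ofReal_mul (abs_nonneg _), abs_of_nonneg (by positivity), deriv_mul_sineRatio ht]
  rw [setLIntegral_congr_fun measurableSet_Ioo heq, ← ofReal_integral_eq_lintegral_ofReal hint,
    integral_const_mul, ← integral_Ioc_eq_integral_Ioo, ← intervalIntegral.integral_of_le hpi,
    integral_idealDensity]
  · congr 1
    ring
  · refine (ae_restrict_iff' measurableSet_Ioo).2 (Eventually.of_forall fun t ht => ?_)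
    have h := deriv_mul_sineRatio ht
    refine le_of_le_of_eq ?_ h
    exact mul_nonneg (by positivity) (hnn (hpos ht))

theorem lintegral_pi_three (μ : Measure ℝ) [SigmaFinite μ] {g : (Fin 3 → ℝ) → ENNReal}
    (hg : Measurable g) :
    ∫⁻ x, g x ∂Measure.pi (fun _ : Fin 3 => μ) = ∫⁻ a, ∫⁻ b, ∫⁻ c, g ![a, b, c] ∂μ ∂μ ∂μ := by
  rw [← ((measurePreserving_piFinSuccAbove (fun _ : Fin 3 => μ) 0).symm).lintegral_comp hg,
    lintegral_prod _ (by fun_prop)]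
  refine lintegral_congr fun a => ?_
  rw [← ((measurePreserving_finTwoArrow μ).symm).lintegral_comp (by fun_prop),
    lintegral_prod _ (by fun_prop)]
  refine lintegral_congr fun b => lintegral_congr fun c => congrArg g ?_
  ext i
  fin_cases i <;> rfl

theorem lintegral_one_div_sq_positiveOctant :
    ∫⁻ x : Fin 3 → ℝ in Set.univ.pi fun _ => Set.Ioi 0,
        ENNReal.ofReal (1 / (x 0 * x 1 + x 1 * x 2 + x 2 * x 0 + x 0 + x 1 + x 2) ^ 2)
      = ENNReal.ofReal (4 * √3 / 3 * clausenTwo (Real.pi / 3)) := by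
  rw [volume_pi, Measure.restrict_pi_pi, lintegral_pi_three _ (by fun_prop), ← lintegral_Ioi_log]
  refine setLIntegral_congr_fun measurableSet_Ioi fun x (hx : 0 < x) => ?_
  rw [← lintegral_Ioi_one_div_mul hx]
  refine setLIntegral_congr_fun measurableSet_Ioi fun y (hy : 0 < y) => ?_
  -- The polynomial is affine in the third variable, with these coefficients.
  have h := lintegral_Ioi_one_div_sq (A := x + (x + 1) * y) (B := x + 1 + y)
    (by positivity) (by positivity)
  rw [← h]
  refine lintegral_congr fun z => ?_
  simp only [Matrix.cons_val]
  congr 3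
  ring

/-! ### Volumes of cones over three-dimensional sets -/

theorem lintegral_Ioi_pow_three_indicator {m : ℝ} (hm : 0 < m) {r : ℝ} (hr : 0 < r) :
    ∫⁻ t in Set.Ioi (0 : ℝ), {t : ℝ | t ^ 2 * m < 1}.indicator
        (fun t => ENNReal.ofReal ((t / r) ^ 3)) t
      = ENNReal.ofReal ((r ^ 3)⁻¹) * ENNReal.ofReal (1 / (4 * m ^ 2)) := by
  have hq : 0 < √m := by positivity
  have hset : {t : ℝ | t ^ 2 * m < 1} ∩ Set.Ioi 0 = Set.Ioo 0 (√m)⁻¹ := by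
    ext t
    simp only [Set.mem_inter_iff, Set.mem_ofPred_eq, Set.mem_Ioi, Set.mem_Ioo]
    rw [and_comm]
    refine and_congr_right fun ht => ?_
    rw [← one_div, lt_div_iff₀ hq, ← sq_lt_one_iff₀ (mul_pos ht hq).le, mul_pow, Real.sq_sqrt hm.le]
  have hmeas : MeasurableSet {t : ℝ | t ^ 2 * m < 1} :=
    measurableSet_lt (by fun_prop) measurable_const
  rw [lintegral_indicator hmeas, Measure.restrict_restrict hmeas, hset,
    ← ofReal_integral_eq_lintegral_ofReal, ← ENNReal.ofReal_mul (by positivity),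
    ← integral_Ioc_eq_integral_Ioo, ← intervalIntegral.integral_of_le (by positivity)]
  · simp only [div_pow, intervalIntegral.integral_div, integral_pow]
    congr 1
    have : (√m)⁻¹ ^ 4 = (m ^ 2)⁻¹ := by
      rw [inv_pow, show √m ^ 4 = (√m ^ 2) ^ 2 by ring, Real.sq_sqrt hm.le]
    norm_num [this]
    field_simp
  · exact (Continuous.integrableOn_Icc (by fun_prop)).mono_set Set.Ioo_subset_Icc_self
  · refine (ae_restrict_iff' measurableSet_Ioo).2 (Eventually.of_forall fun t ht => ?_)
    have := ht.1
    rw [Pi.zero_apply]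
    positivity

/-- The slice at height `t` is the part of `D` with `t² f < 1`, scaled by `t / r`. By Tonelli each
`x ∈ D` contributes the integral of `(t / r)³` over `0 < t < 1 / √(f x)`. In the applications `X₃²
f(r X' / X₃)`, with `X'` the first three coordinates, is a quadratic form in `X`. -/
theorem volume_cone {r : ℝ} (hr : 0 < r) {D : Set (Fin 3 → ℝ)} (hD : MeasurableSet D)
    {f : (Fin 3 → ℝ) → ℝ} (hf : Measurable f) (hpos : ∀ x ∈ D, 0 < f x) :
    ENNReal.ofReal (r ^ 3) * volume {X : Fin 4 → ℝ | 0 < X 3 ∧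
        (r / X 3) • ![X 0, X 1, X 2] ∈ D ∧ X 3 ^ 2 * f ((r / X 3) • ![X 0, X 1, X 2]) < 1}
      = ∫⁻ x in D, ENNReal.ofReal (1 / (4 * f x ^ 2)) := by
  set E : Set (ℝ × (Fin 3 → ℝ)) :=
    {p | 0 < p.1 ∧ (r / p.1) • p.2 ∈ D ∧ p.1 ^ 2 * f ((r / p.1) • p.2) < 1} with hE
  have hEm : MeasurableSet E := by
    have h1 : Measurable fun p : ℝ × (Fin 3 → ℝ) => (r / p.1) • p.2 := by fun_prop
    have h2 : Measurable fun p : ℝ × (Fin 3 → ℝ) => p.1 ^ 2 * f ((r / p.1) • p.2) := by fun_prop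
    exact (measurableSet_lt measurable_const measurable_fst).inter
      ((h1 hD).inter (measurableSet_lt h2 measurable_const))
  have e1 : {X : Fin 4 → ℝ | 0 < X 3 ∧ (r / X 3) • ![X 0, X 1, X 2] ∈ D ∧
      X 3 ^ 2 * f ((r / X 3) • ![X 0, X 1, X 2]) < 1}
      = MeasurableEquiv.piFinSuccAbove (fun _ : Fin 4 => ℝ) 3 ⁻¹' E := by
    ext X
    have : (MeasurableEquiv.piFinSuccAbove (fun _ : Fin 4 => ℝ) 3 X)
        = (X 3, ![X 0, X 1, X 2]) := by
      refine Prod.ext rfl ?_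
      ext i
      fin_cases i <;> rfl
    rw [Set.mem_preimage, this]
    rfl
  rw [e1, (volume_preserving_piFinSuccAbove (fun _ : Fin 4 => ℝ) 3).measure_preimage
    hEm.nullMeasurableSet, Measure.volume_eq_prod, Measure.prod_apply hEm]
  have e2 : ∀ t : ℝ, volume (Prod.mk t ⁻¹' E) = (Set.Ioi (0 : ℝ)).indicator (fun t =>
      ∫⁻ x in D, {t : ℝ | t ^ 2 * f x < 1}.indicator (fun t => ENNReal.ofReal ((t / r) ^ 3)) t) t := by
    intro t
    by_cases ht : 0 < t
    · rw [Set.indicator_of_mem (Set.mem_Ioi.2 ht)]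
      have hS : MeasurableSet {x | t ^ 2 * f x < 1} := measurableSet_lt (by fun_prop) measurable_const
      have h1 : Prod.mk t ⁻¹' E = ((r / t) • ·) ⁻¹' ({x | t ^ 2 * f x < 1} ∩ D) := by
        ext y
        simp [hE, ht, and_comm]
      rw [h1, Measure.addHaar_preimage_smul _ (by positivity), Module.finrank_fin_fun,
        ← inv_pow, inv_div, abs_of_pos (by positivity), ← Measure.restrict_apply hS,
        ← lintegral_indicator_const hS]
      rfl
    · rw [Set.indicator_of_notMem (by simpa using ht)]
      have h1 : Prod.mk t ⁻¹' E = ∅ := by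
        ext y
        simp [hE, ht]
      rw [h1, measure_empty]
  simp only [e2]
  rw [lintegral_indicator measurableSet_Ioi, lintegral_lintegral_swap]
  · rw [setLIntegral_congr_fun hD fun x hx => lintegral_Ioi_pow_three_indicator (hpos x hx) hr,
      lintegral_const_mul _ (by fun_prop), ← mul_assoc, ← ENNReal.ofReal_mul (by positivity),
      mul_inv_cancel₀ (by positivity), ENNReal.ofReal_one, one_mul]
  · refine Measurable.aemeasurable ?_
    have h1 : MeasurableSet {p : ℝ × (Fin 3 → ℝ) | p.1 ^ 2 * f p.2 < 1} :=
      measurableSet_lt (by fun_prop) measurable_const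
    exact Measurable.indicator (f := fun p : ℝ × (Fin 3 → ℝ) => ENNReal.ofReal ((p.1 / r) ^ 3))
      (by fun_prop) h1

/-! ### The region cut out by the Gram form -/

/-- The quadratic form with diagonal entries `s` and off-diagonal entries `1`. -/
def gramForm (s : ℝ) (c : Fin 4 → ℝ) : ℝ :=
  s * (c 0 ^ 2 + c 1 ^ 2 + c 2 ^ 2 + c 3 ^ 2)
    + 2 * (c 0 * c 1 + c 0 * c 2 + c 0 * c 3 + c 1 * c 2 + c 1 * c 3 + c 2 * c 3)

/-- The part of the positive orthant where `gramForm s` is less than one. -/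
def gramRegion (s : ℝ) : Set (Fin 4 → ℝ) :=
  {c | (∀ i, 0 < c i) ∧ gramForm s c < 1}

theorem measurable_gramForm (s : ℝ) : Measurable (gramForm s) := by
  unfold gramForm
  fun_prop

theorem measurableSet_gramRegion (s : ℝ) : MeasurableSet (gramRegion s) := by
  refine MeasurableSet.inter ?_ (measurableSet_lt (measurable_gramForm s) measurable_const)
  have : MeasurableSet (⋂ i : Fin 4, {c : Fin 4 → ℝ | 0 < c i}) :=
    MeasurableSet.iInter fun i => measurableSet_lt measurable_const (measurable_pi_apply i)
  have h : (⋂ i : Fin 4, {c : Fin 4 → ℝ | 0 < c i}) = {c | ∀ i, 0 < c i} := by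
    ext c
    exact Set.mem_iInter
  rwa [h] at this

theorem gramForm_pos {s : ℝ} (hs : 0 ≤ s) {c : Fin 4 → ℝ} (hc : ∀ i, 0 < c i) :
    0 < gramForm s c := by
  have := hc 0
  have := hc 1
  have := hc 2
  have := hc 3
  unfold gramForm
  positivity

theorem gramForm_le_gramForm {s t : ℝ} (h : s ≤ t) (c : Fin 4 → ℝ) :
    gramForm s c ≤ gramForm t c := by
  unfold gramForm
  gcongr

theorem gramRegion_subset_gramRegion {s t : ℝ} (h : s ≤ t) : gramRegion t ⊆ gramRegion s :=
  fun c hc => ⟨hc.1, (gramForm_le_gramForm h c).trans_lt hc.2⟩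

/-- The two sets differ only on the coordinate hyperplanes, which are null. The condition `0 <
gramForm s c` matters on the boundary: for `s = 0` the form vanishes along the axes. -/
theorem volume_gramRegion_eq_volume_orthant {s : ℝ} (hs : 0 ≤ s) :
    volume {c : Fin 4 → ℝ | (∀ i, 0 ≤ c i) ∧ 0 < gramForm s c ∧ gramForm s c < 1}
      = volume (gramRegion s) := by
  refine measure_congr ?_
  have h : ∀ᵐ c : Fin 4 → ℝ, ∀ i, c i ≠ 0 := by
    refine ae_all_iff.2 fun i => ?_
    rw [ae_iff, volume_pi]
    simpa using Measure.pi_hyperplane (fun _ : Fin 4 => (volume : Measure ℝ)) i 0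
  filter_upwards [h] with c hc
  refine propext ⟨fun h => ⟨fun i => (h.1 i).lt_of_ne' (hc i), h.2.2⟩,
    fun h => ⟨fun i => (h.1 i).le, gramForm_pos hs h.1, h.2⟩⟩

theorem volume_gramRegion_zero :
    volume (gramRegion 0) = ENNReal.ofReal (√3 / 12 * clausenTwo (Real.pi / 3)) := by
  set f : (Fin 3 → ℝ) → ℝ :=
    fun x => 2 * (x 0 * x 1 + x 1 * x 2 + x 2 * x 0 + x 0 + x 1 + x 2)
  have hD : MeasurableSet (Set.univ.pi fun _ : Fin 3 => Set.Ioi (0 : ℝ)) :=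
    MeasurableSet.univ_pi fun _ => measurableSet_Ioi
  have hpos : ∀ x ∈ Set.univ.pi fun _ : Fin 3 => Set.Ioi (0 : ℝ), 0 < f x := by
    intro x hx
    have h0 : 0 < x 0 := hx 0 trivial
    have h1 : 0 < x 1 := hx 1 trivial
    have h2 : 0 < x 2 := hx 2 trivial
    simp only [f]
    positivity
  have h := volume_cone one_pos hD (f := f) (by fun_prop) hpos
  rw [one_pow, ENNReal.ofReal_one, one_mul] at h
  have hset : gramRegion 0 = {X : Fin 4 → ℝ | 0 < X 3 ∧
      (1 / X 3) • ![X 0, X 1, X 2] ∈ Set.univ.pi (fun _ : Fin 3 => Set.Ioi (0 : ℝ)) ∧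
        X 3 ^ 2 * f ((1 / X 3) • ![X 0, X 1, X 2]) < 1} := by
    ext X
    have hf (h : 0 < X 3) : X 3 ^ 2 * f ((1 / X 3) • ![X 0, X 1, X 2]) = gramForm 0 X := by
      simp only [f, gramForm, Pi.smul_apply, smul_eq_mul, Matrix.cons_val]
      field_simp
      ring
    have hm (h : 0 < X 3) : (1 / X 3) • ![X 0, X 1, X 2] ∈
        Set.univ.pi (fun _ : Fin 3 => Set.Ioi (0 : ℝ)) ↔ 0 < X 0 ∧ 0 < X 1 ∧ 0 < X 2 := by
      simp [Set.mem_pi, Fin.forall_fin_succ, h]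
    refine ⟨fun hX => ⟨hX.1 3, (hm (hX.1 3)).2 ⟨hX.1 0, hX.1 1, hX.1 2⟩,
      (hf (hX.1 3)).trans_lt hX.2⟩, fun ⟨h3, hX, h⟩ => ⟨?_, (hf h3).symm.trans_lt h⟩⟩
    obtain ⟨h0, h1, h2⟩ := (hm h3).1 hX
    intro i
    fin_cases i <;> assumption
  rw [hset, h]
  have e (x : Fin 3 → ℝ) : ENNReal.ofReal (1 / (4 * f x ^ 2)) = ENNReal.ofReal (1 / 16) *
      ENNReal.ofReal (1 / (x 0 * x 1 + x 1 * x 2 + x 2 * x 0 + x 0 + x 1 + x 2) ^ 2) := by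
    rw [← ENNReal.ofReal_mul (by norm_num)]
    congr 1
    simp only [f]
    rw [mul_pow, one_div_mul_one_div]
    ring
  simp only [e]
  rw [lintegral_const_mul _ (by fun_prop), lintegral_one_div_sq_positiveOctant,
    ← ENNReal.ofReal_mul (by norm_num)]
  congr 1
  ring

theorem volume_gramRegion_lt_top {s : ℝ} (hs : 0 ≤ s) : volume (gramRegion s) < ⊤ :=
  (measure_mono (gramRegion_subset_gramRegion hs)).trans_lt
    (volume_gramRegion_zero ▸ ENNReal.ofReal_lt_top)

/-- The regions grow as `s` decreases and lie in `gramRegion 0`, which has finite measure; the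
strict inequality `< 1` persists for small `s`, so the indicators converge everywhere. -/
theorem tendsto_volume_gramRegion :
    Tendsto (fun s => volume (gramRegion s)) (𝓝[>] 0) (𝓝 (volume (gramRegion 0))) := by
  refine tendsto_measure_of_ae_tendsto_indicator (𝓝[>] 0) (measurableSet_gramRegion 0)
    measurableSet_gramRegion (measurableSet_gramRegion 0)
    (volume_gramRegion_lt_top le_rfl).ne ?_ ?_
  · filter_upwards [self_mem_nhdsWithin] with s hs using
      gramRegion_subset_gramRegion (le_of_lt hs)
  · refine Eventually.of_forall fun c => ?_
    by_cases hc : c ∈ gramRegion 0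
    · have h : Tendsto (fun s => gramForm s c) (𝓝[>] 0) (𝓝 (gramForm 0 c)) :=
        tendsto_nhdsWithin_of_tendsto_nhds
          (Continuous.tendsto (by unfold gramForm; fun_prop) 0)
      filter_upwards [h.eventually_lt_const hc.2] with s hs
      exact iff_of_true ⟨hc.1, hs⟩ hc
    · filter_upwards [self_mem_nhdsWithin] with s hs
      exact iff_of_false (fun h => hc (gramRegion_subset_gramRegion (le_of_lt hs) h)) hc

/-! ### The Riemannian volume element in Klein coordinates -/

theorem hasDerivAt_kleinChart_line {r : ℝ} {x : Fin 3 → ℝ} (hx : x ∈ kleinBall r)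
    (v : Fin 3 → ℝ) :
    HasDerivAt (fun t : ℝ => kleinChart r (x + t • v))
      ((r * (x 0 * v 0 + x 1 * v 1 + x 2 * v 2)
          / √(r ^ 2 - (x 0 ^ 2 + x 1 ^ 2 + x 2 ^ 2)) ^ 3) • ![x 0, x 1, x 2, r]
        + (r / √(r ^ 2 - (x 0 ^ 2 + x 1 ^ 2 + x 2 ^ 2))) • ![v 0, v 1, v 2, 0]) 0 := by
  have hx' : 0 < r ^ 2 - (x 0 ^ 2 + x 1 ^ 2 + x 2 ^ 2) := sub_pos.2 hx
  have hl (i : Fin 3) : HasDerivAt (fun t : ℝ => (x + t • v) i) (v i) 0 := by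
    simpa using ((hasDerivAt_id (0 : ℝ)).mul_const (v i)).const_add (x i)
  have h1 : HasDerivAt (fun t : ℝ => r ^ 2 - ((x + t • v) 0 ^ 2 + (x + t • v) 1 ^ 2
      + (x + t • v) 2 ^ 2)) (-(2 * (x 0 * v 0 + x 1 * v 1 + x 2 * v 2))) 0 := by
    refine (((((hl 0).pow 2).add ((hl 1).pow 2)).add ((hl 2).pow 2)).const_sub (r ^ 2)).congr_deriv ?_
    simp
    ring
  have h2 := ((h1.sqrt (by simpa using hx'.ne')).fun_inv (by simpa using (Real.sqrt_pos.2 hx').ne')).const_mul r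
  have h3 : HasDerivAt (fun t : ℝ => ![(x + t • v) 0, (x + t • v) 1, (x + t • v) 2, r])
      ![v 0, v 1, v 2, 0] 0 := by
    refine hasDerivAt_pi.2 fun i => ?_
    fin_cases i
    · exact hl 0
    · exact hl 1
    · exact hl 2
    · exact hasDerivAt_const _ _
  refine (h2.smul h3).congr_deriv ?_
  have h4 := (Real.sqrt_pos.2 hx').ne'
  simp only [zero_smul, add_zero]
  rw [add_comm]
  congr 2
  field_simp

theorem differentiableAt_kleinChart {r : ℝ} {x : Fin 3 → ℝ} (hx : x ∈ kleinBall r) :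
    DifferentiableAt ℝ (kleinChart r) x := by
  have hx' : r ^ 2 - (x 0 ^ 2 + x 1 ^ 2 + x 2 ^ 2) ≠ 0 := (sub_pos.2 hx).ne'
  have hx'' : √(r ^ 2 - (x 0 ^ 2 + x 1 ^ 2 + x 2 ^ 2)) ≠ 0 := (Real.sqrt_pos.2 (sub_pos.2 hx)).ne'
  unfold kleinChart
  refine DifferentiableAt.fun_smul ?_ (differentiableAt_pi.2 fun i => ?_)
  · fun_prop (disch := assumption)
  · fin_cases i <;> simp <;> fun_prop

theorem fderiv_kleinChart {r : ℝ} {x : Fin 3 → ℝ} (hx : x ∈ kleinBall r) (v : Fin 3 → ℝ) :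
    fderiv ℝ (kleinChart r) x v =
      (r * (x 0 * v 0 + x 1 * v 1 + x 2 * v 2)
          / √(r ^ 2 - (x 0 ^ 2 + x 1 ^ 2 + x 2 ^ 2)) ^ 3) • ![x 0, x 1, x 2, r]
        + (r / √(r ^ 2 - (x 0 ^ 2 + x 1 ^ 2 + x 2 ^ 2))) • ![v 0, v 1, v 2, 0] := by
  rw [← (differentiableAt_kleinChart hx).lineDeriv_eq_fderiv, lineDeriv,
    (hasDerivAt_kleinChart_line hx v).deriv]

theorem minkowski_fderiv_kleinChart {r : ℝ} {x : Fin 3 → ℝ} (hx : x ∈ kleinBall r)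
    (u v : Fin 3 → ℝ) :
    minkowski (fderiv ℝ (kleinChart r) x u) (fderiv ℝ (kleinChart r) x v) =
      r ^ 2 * ((u 0 * v 0 + u 1 * v 1 + u 2 * v 2) / (r ^ 2 - (x 0 ^ 2 + x 1 ^ 2 + x 2 ^ 2))
        + (x 0 * u 0 + x 1 * u 1 + x 2 * u 2) * (x 0 * v 0 + x 1 * v 1 + x 2 * v 2)
          / (r ^ 2 - (x 0 ^ 2 + x 1 ^ 2 + x 2 ^ 2)) ^ 2) := by
  have hx' : 0 < r ^ 2 - (x 0 ^ 2 + x 1 ^ 2 + x 2 ^ 2) := sub_pos.2 hx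
  have hw : 0 < √(r ^ 2 - (x 0 ^ 2 + x 1 ^ 2 + x 2 ^ 2)) := Real.sqrt_pos.2 hx'
  have hw2 : √(r ^ 2 - (x 0 ^ 2 + x 1 ^ 2 + x 2 ^ 2)) ^ 2
    = r ^ 2 - (x 0 ^ 2 + x 1 ^ 2 + x 2 ^ 2) := Real.sq_sqrt hx'.le
  rw [fderiv_kleinChart hx, fderiv_kleinChart hx]
  set w := √(r ^ 2 - (x 0 ^ 2 + x 1 ^ 2 + x 2 ^ 2))
  clear_value w
  rw [← hw2]
  simp only [minkowski, Pi.add_apply, Pi.smul_apply, smul_eq_mul, Matrix.cons_val]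
  have hi : w⁻¹ ^ 2 * w ^ 2 = 1 := by
    rw [← mul_pow, inv_mul_cancel₀ hw.ne', one_pow]
  linear_combination r ^ 2 * (x 0 * u 0 + x 1 * u 1 + x 2 * u 2)
    * (x 0 * v 0 + x 1 * v 1 + x 2 * v 2) * w⁻¹ ^ 4 * (w⁻¹ ^ 2 * hw2 - hi)

/-- With `q = r² - |x|²` the metric is `(r²/q) (I + x xᵀ / q)`, a rank-one perturbation, so its
determinant is `(r²/q)³ (1 + |x|²/q) = r⁸ / q⁴`. -/
theorem det_kleinMetric {r : ℝ} {x : Fin 3 → ℝ} (hx : x ∈ kleinBall r) :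
    (kleinMetric r x).det = (r ^ 4 / (r ^ 2 - (x 0 ^ 2 + x 1 ^ 2 + x 2 ^ 2)) ^ 2) ^ 2 := by
  have hx' : r ^ 2 - (x 0 ^ 2 + x 1 ^ 2 + x 2 ^ 2) ≠ 0 := (sub_pos.2 hx).ne'
  simp only [Matrix.det_fin_three, kleinMetric, Matrix.of_apply, minkowski_fderiv_kleinChart hx]
  simp
  field_simp
  ring

theorem sqrt_abs_det_kleinMetric {r : ℝ} {x : Fin 3 → ℝ} (hx : x ∈ kleinBall r) :
    √|(kleinMetric r x).det| = r ^ 4 / (r ^ 2 - (x 0 ^ 2 + x 1 ^ 2 + x 2 ^ 2)) ^ 2 := by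
  rw [det_kleinMetric hx, abs_of_nonneg (by positivity), Real.sqrt_sq (by positivity)]

/-! ### Tetrahedra with a prescribed Gram matrix -/

/-- The linear map that sends coefficients `c` to the combination `∑ i, c i • w i`. -/
noncomputable def combinationMap (w : Fin 4 → Fin 4 → ℝ) : (Fin 4 → ℝ) →ₗ[ℝ] (Fin 4 → ℝ) :=
  Matrix.toLin' (Matrix.of w).transpose

theorem combinationMap_apply (w : Fin 4 → Fin 4 → ℝ) (c : Fin 4 → ℝ) :
    combinationMap w c = ∑ i, c i • w i := by
  ext j
  simp [combinationMap, Matrix.mulVec, dotProduct, mul_comm]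

theorem minkowski_combinationMap {s : ℝ} {w : Fin 4 → Fin 4 → ℝ}
    (hG : ∀ i j, minkowski (w i) (w j) = if i = j then -s else -1) (c : Fin 4 → ℝ) :
    -minkowski (combinationMap w c) (combinationMap w c) = gramForm s c := by
  have h (i j : Fin 4) := hG i j
  simp only [minkowski] at h
  rw [combinationMap_apply]
  simp only [minkowski, gramForm, Fin.sum_univ_four, Pi.add_apply, Pi.smul_apply, smul_eq_mul]
  have h00 := h 0 0
  have h11 := h 1 1
  have h22 := h 2 2
  have h33 := h 3 3
  have h01 := h 0 1
  have h02 := h 0 2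
  have h03 := h 0 3
  have h12 := h 1 2
  have h13 := h 1 3
  have h23 := h 2 3
  norm_num at h00 h11 h22 h33
  rw [if_neg (by decide)] at h01 h02 h03 h12 h13 h23
  linear_combination -(c 0 ^ 2 * h00 + c 1 ^ 2 * h11 + c 2 ^ 2 * h22 + c 3 ^ 2 * h33
    + 2 * (c 0 * c 1 * h01 + c 0 * c 2 * h02 + c 0 * c 3 * h03 + c 1 * c 2 * h12
      + c 1 * c 3 * h13 + c 2 * c 3 * h23))

/-- Take determinants in `W η Wᵀ = G`, with `η` the Minkowski matrix. The Gram matrix `G` is `(1 -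
s) I - J`, `J` all ones, with eigenvalue `1 - s` three times and `-(3 + s)` once. -/
theorem sq_det_combinationMap {s : ℝ} {w : Fin 4 → Fin 4 → ℝ}
    (hG : ∀ i j, minkowski (w i) (w j) = if i = j then -s else -1) :
    LinearMap.det (combinationMap w) ^ 2 = (1 - s) ^ 3 * (3 + s) := by
  rw [combinationMap, LinearMap.det_toLin', Matrix.det_transpose]
  have h1 : Matrix.of w * Matrix.diagonal ![1, 1, 1, -1] * (Matrix.of w).transpose
      = Matrix.of fun i j => if i = j then -s else -1 := by
    ext i j
    rw [Matrix.of_apply, ← hG i j]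
    simp [Matrix.mul_apply, Fin.sum_univ_four, minkowski]
    ring
  have h2 := congrArg Matrix.det h1
  rw [Matrix.det_mul, Matrix.det_mul, Matrix.det_transpose, Matrix.det_diagonal,
    Fin.prod_univ_four] at h2
  have h3 : (Matrix.of fun i j : Fin 4 => if i = j then -s else (-1 : ℝ)).det
      = -((1 - s) ^ 3 * (3 + s)) := by
    have h4 : (Matrix.of fun i j : Fin 4 => if i = j then -s else (-1 : ℝ))
        = !![-s, -1, -1, -1; -1, -s, -1, -1; -1, -1, -s, -1; -1, -1, -1, -s] := by
      ext i j
      fin_cases i <;> fin_cases j <;> rfl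
    rw [h4, Matrix.det_succ_row_zero]
    simp [Fin.sum_univ_succ, Matrix.det_fin_three, Fin.succAbove]
    ring
  rw [h3] at h2
  simp only [Matrix.cons_val] at h2
  linear_combination -h2

theorem abs_det_combinationMap {s : ℝ} {w : Fin 4 → Fin 4 → ℝ}
    (hG : ∀ i j, minkowski (w i) (w j) = if i = j then -s else -1) :
    |LinearMap.det (combinationMap w)| = √((1 - s) ^ 3 * (3 + s)) := by
  rw [← sq_det_combinationMap hG, Real.sqrt_sq_eq_abs]

theorem minkowski_smul_smul (a b : ℝ) (X Y : Fin 4 → ℝ) :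
    minkowski (a • X) (b • Y) = a * b * minkowski X Y := by
  simp only [minkowski, Pi.smul_apply, smul_eq_mul]
  ring

theorem kleinChart_mem_geodesicTetrahedron_iff {r : ℝ} (hr : 0 < r) {x : Fin 3 → ℝ}
    (hx : x ∈ kleinBall r) (w : Fin 4 → Fin 4 → ℝ) :
    kleinChart r x ∈ geodesicTetrahedron r w
      ↔ ∃ c : Fin 4 → ℝ, (∀ i, 0 ≤ c i) ∧ ![x 0, x 1, x 2, r] = combinationMap w c := by
  have hx' : 0 < r ^ 2 - (x 0 ^ 2 + x 1 ^ 2 + x 2 ^ 2) := sub_pos.2 hx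
  have hw : 0 < √(r ^ 2 - (x 0 ^ 2 + x 1 ^ 2 + x 2 ^ 2)) := Real.sqrt_pos.2 hx'
  have hk : 0 < r / √(r ^ 2 - (x 0 ^ 2 + x 1 ^ 2 + x 2 ^ 2)) := by positivity
  have hH : kleinChart r x ∈ hyperboloid r := by
    refine ⟨?_, ?_⟩
    · rw [kleinChart, minkowski_smul_smul, ← sq, div_pow, Real.sq_sqrt hx'.le]
      simp only [minkowski, Matrix.cons_val]
      field_simp
      ring
    · exact mul_pos hk hr
  simp only [← combinationMap_apply, geodesicTetrahedron, kleinChart] at hH ⊢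
  set k := r / √(r ^ 2 - (x 0 ^ 2 + x 1 ^ 2 + x 2 ^ 2))
  constructor
  · rintro ⟨-, c, hc, h⟩
    refine ⟨k⁻¹ • c, fun i => mul_nonneg (inv_pos.2 hk).le (hc i), ?_⟩
    rw [map_smul, ← h, inv_smul_smul₀ hk.ne']
  · rintro ⟨c, hc, h⟩
    refine ⟨hH, k • c, fun i => mul_nonneg hk.le (hc i), ?_⟩
    rw [map_smul, ← h]

theorem hyperbolicVolume_geodesicTetrahedron {r s : ℝ} (hr : 0 < r) (hs0 : 0 ≤ s) (hs1 : s < 1)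
    {w : Fin 4 → Fin 4 → ℝ} (hw : ∀ i, 0 < w i 3)
    (hG : ∀ i j, minkowski (w i) (w j) = if i = j then -s else -1) :
    hyperbolicVolume r (geodesicTetrahedron r w)
      = ENNReal.ofReal (4 * r ^ 3 * √((1 - s) ^ 3 * (3 + s))) * volume (gramRegion s) := by
  set A := combinationMap w
  have hdet : LinearMap.det A ≠ 0 := by
    have h := sq_det_combinationMap hG
    have : 0 < 1 - s := sub_pos.2 hs1
    intro h0
    have h' : 0 < (1 - s) ^ 3 * (3 + s) := by positivity
    rw [← h, h0] at h'
    simp at h'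
  set B := (A.equivOfDetNeZero hdet).symm
  set D : Set (Fin 3 → ℝ) := {x | x ∈ kleinBall r ∧ kleinChart r x ∈ geodesicTetrahedron r w}
  have hDB : D = kleinBall r ∩ {x | ∀ i, 0 ≤ B ![x 0, x 1, x 2, r] i} := by
    ext x
    refine and_congr_right fun hx => ?_
    rw [kleinChart_mem_geodesicTetrahedron_iff hr hx]
    constructor
    · rintro ⟨c, hc, h⟩ i
      have : B ![x 0, x 1, x 2, r] = c := by
        rw [h]
        exact (A.equivOfDetNeZero hdet).symm_apply_apply c
      rw [this]
      exact hc i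
    · intro h
      exact ⟨_, h, ((A.equivOfDetNeZero hdet).apply_symm_apply _).symm⟩
  have hball : MeasurableSet (kleinBall r) :=
    measurableSet_lt (by fun_prop) measurable_const
  have hDm : MeasurableSet D := by
    rw [hDB]
    refine hball.inter ?_
    have h1 : Measurable fun x : Fin 3 → ℝ => B ![x 0, x 1, x 2, r] := by
      refine (LinearMap.continuous_of_finiteDimensional B.toLinearMap).measurable.comp ?_
      refine measurable_pi_iff.2 fun i => ?_
      fin_cases i <;> simp <;> fun_prop
    have h2 : {x : Fin 3 → ℝ | ∀ i, 0 ≤ B ![x 0, x 1, x 2, r] i}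
        = ⋂ i, {x | 0 ≤ B ![x 0, x 1, x 2, r] i} := by
      ext x
      rw [Set.mem_iInter]
      rfl
    rw [h2]
    exact MeasurableSet.iInter fun i => measurableSet_le measurable_const
      ((measurable_pi_apply i).comp h1)
  -- Chosen so that `X₃² f(r X' / X₃) = -⟨X, X⟩` with `X' = (X₀, X₁, X₂)`, and so that the volume
  -- density is `1 / f²`.
  set f : (Fin 3 → ℝ) → ℝ := fun x => (r ^ 2 - (x 0 ^ 2 + x 1 ^ 2 + x 2 ^ 2)) / r ^ 2 with hf
  have hfpos : ∀ x ∈ D, 0 < f x := fun x hx => div_pos (sub_pos.2 hx.1) (by positivity)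
  have hcone := volume_cone hr hDm (f := f) (by fun_prop) hfpos
  have hset : {X : Fin 4 → ℝ | 0 < X 3 ∧ (r / X 3) • ![X 0, X 1, X 2] ∈ D ∧
      X 3 ^ 2 * f ((r / X 3) • ![X 0, X 1, X 2]) < 1}
      = A '' {c | (∀ i, 0 ≤ c i) ∧ 0 < gramForm s c ∧ gramForm s c < 1} := by
    have hq {X : Fin 4 → ℝ} (hX : 0 < X 3) :
        X 3 ^ 2 * f ((r / X 3) • ![X 0, X 1, X 2]) = -minkowski X X := by
      simp only [hf, minkowski, Pi.smul_apply, smul_eq_mul, Matrix.cons_val]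
      field_simp
      ring
    have hb {X : Fin 4 → ℝ} (hX : 0 < X 3) :
        (r / X 3) • ![X 0, X 1, X 2] ∈ kleinBall r ↔ 0 < -minkowski X X := by
      rw [← hq hX, mul_pos_iff_of_pos_left (by positivity), hf, div_pos_iff_of_pos_right
        (by positivity), sub_pos]
      rfl
    have hv {X : Fin 4 → ℝ} (hX : 0 < X 3) :
        ![((r / X 3) • ![X 0, X 1, X 2]) 0, ((r / X 3) • ![X 0, X 1, X 2]) 1,
          ((r / X 3) • ![X 0, X 1, X 2]) 2, r] = (r / X 3) • X := by
      ext i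
      fin_cases i
      · rfl
      · rfl
      · rfl
      · exact (div_mul_cancel₀ r hX.ne').symm
    ext X
    constructor
    · rintro ⟨hX, ⟨h1, h2⟩, h3⟩
      rw [kleinChart_mem_geodesicTetrahedron_iff hr h1, hv hX] at h2
      obtain ⟨c, hc, h⟩ := h2
      have hAc : A ((r / X 3)⁻¹ • c) = X := by
        rw [map_smul, ← h, inv_smul_smul₀ (by positivity)]
      refine ⟨(r / X 3)⁻¹ • c, ⟨fun i => mul_nonneg (by positivity) (hc i), ?_⟩, hAc⟩
      rw [← minkowski_combinationMap hG, hAc]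
      exact ⟨(hb hX).1 h1, (hq hX).symm.trans_lt h3⟩
    · rintro ⟨c, ⟨hc, h1, h2⟩, rfl⟩
      rw [← minkowski_combinationMap hG] at h1 h2
      have hX : 0 < A c 3 := by
        have hnn : ∀ i ∈ Finset.univ, 0 ≤ c i * w i 3 := fun i _ => mul_nonneg (hc i) (hw i).le
        have hsum : A c 3 = ∑ i, c i * w i 3 := by
          rw [combinationMap_apply, Finset.sum_apply]
          rfl
        rw [hsum]
        -- A nonnegative combination of future-directed vectors has zero height only if `c = 0`,
        -- which `0 < gramForm s c` excludes.
        refine (Finset.sum_nonneg hnn).lt_of_ne' fun h0 => ?_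
        have hc0 : c = 0 := funext fun i => by
          have := (Finset.sum_eq_zero_iff_of_nonneg hnn).1 h0 i (Finset.mem_univ i)
          exact (mul_eq_zero.1 this).resolve_right (hw i).ne'
        rw [hc0, map_zero] at h1
        simp [minkowski] at h1
      refine ⟨hX, ⟨(hb hX).2 h1, ?_⟩, (hq hX).trans_lt h2⟩
      rw [kleinChart_mem_geodesicTetrahedron_iff hr ((hb hX).2 h1), hv hX]
      exact ⟨(r / A c 3) • c, fun i => mul_nonneg (by positivity) (hc i), (map_smul _ _ _).symm⟩
  have hvol : hyperbolicVolume r (geodesicTetrahedron r w)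
      = ∫⁻ x in D, ENNReal.ofReal 4 * ENNReal.ofReal (1 / (4 * f x ^ 2)) := by
    refine setLIntegral_congr_fun hDm fun x hx => ?_
    have : 0 < r ^ 2 - (x 0 ^ 2 + x 1 ^ 2 + x 2 ^ 2) := sub_pos.2 hx.1
    rw [sqrt_abs_det_kleinMetric hx.1, ← ENNReal.ofReal_mul (by norm_num), hf]
    congr 1
    field_simp
  rw [hvol, lintegral_const_mul _ (by fun_prop), ← hcone, hset, Measure.addHaar_image_linearMap,
    abs_det_combinationMap hG, volume_gramRegion_eq_volume_orthant hs0, ← mul_assoc, ← mul_assoc,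
    ← ENNReal.ofReal_mul (by norm_num), ← ENNReal.ofReal_mul (by positivity)]

/-! ### Regular tetrahedra of finite edge length -/

theorem geodesicTetrahedron_smul (r : ℝ) (v : Fin 4 → Fin 4 → ℝ) {k : Fin 4 → ℝ}
    (hk : ∀ i, 0 < k i) : geodesicTetrahedron r (fun i => k i • v i) = geodesicTetrahedron r v := by
  ext X
  refine and_congr_right fun _ => ⟨?_, ?_⟩
  · rintro ⟨c, hc, rfl⟩
    exact ⟨fun i => c i * k i, fun i => mul_nonneg (hc i) (hk i).le, by simp only [mul_smul]⟩
  · rintro ⟨c, hc, rfl⟩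
    refine ⟨fun i => c i / k i, fun i => div_nonneg (hc i) (hk i).le, ?_⟩
    simp only [smul_smul, div_mul_cancel₀ _ (hk _).ne']

theorem minkowski_comm (X Y : Fin 4 → ℝ) : minkowski X Y = minkowski Y X := by
  unfold minkowski
  ring

/-- Covers the default values of `Real.arcosh` outside its natural domain: a positive edge length
then forces the argument to be at least `1`. -/
theorem arcosh_nonpos {y : ℝ} (hy : y ≤ 1) : Real.arcosh y ≤ 0 := by
  rw [Real.arcosh, ← Real.log_abs]
  refine Real.log_nonpos (abs_nonneg _) (abs_le.2 ?_)
  rcases le_or_gt (y ^ 2 - 1) 0 with h | h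
  · rw [Real.sqrt_eq_zero_of_nonpos h, add_zero]
    exact abs_le.1 (abs_le_one_iff_mul_self_le_one.2 (by linarith))
  · have hy1 : y < -1 := by nlinarith
    have h1 : √(y ^ 2 - 1) ≤ -y := Real.sqrt_le_iff.2 ⟨by linarith, by linarith [neg_sq y]⟩
    have h2 : -1 - y ≤ √(y ^ 2 - 1) := Real.le_sqrt_of_sq_le (by nlinarith)
    exact ⟨by linarith, by linarith⟩

theorem minkowski_of_hyperbolicDist_eq {r a : ℝ} (hr : 0 < r) (ha : 0 < a) {X Y : Fin 4 → ℝ}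
    (h : hyperbolicDist r X Y = a) : minkowski X Y = -r ^ 2 * Real.cosh (a / r) := by
  have h1 : Real.arcosh (-minkowski X Y / r ^ 2) = a / r := by
    rw [← h, hyperbolicDist, mul_div_cancel_left₀ _ hr.ne']
  have h2 : 1 ≤ -minkowski X Y / r ^ 2 := by
    by_contra! hlt
    have := arcosh_nonpos hlt.le
    rw [h1] at this
    exact absurd (div_pos ha hr) this.not_gt
  rw [← h1, Real.cosh_arcosh h2]
  field_simp

/-- The volume of the regular tetrahedron of edge length `a`. -/
noncomputable def regularTetrahedronVolume (r a : ℝ) : ℝ :=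
  4 * r ^ 3 * √((1 - (Real.cosh (a / r))⁻¹) ^ 3 * (3 + (Real.cosh (a / r))⁻¹))
    * (volume (gramRegion (Real.cosh (a / r))⁻¹)).toReal

theorem inv_cosh_mem_Ioo {x : ℝ} (hx : 0 < x) : (Real.cosh x)⁻¹ ∈ Set.Ioo 0 1 :=
  ⟨inv_pos.2 (Real.cosh_pos x), inv_lt_one_of_one_lt₀ (Real.one_lt_cosh.2 hx.ne')⟩

theorem hyperbolicVolume_of_isRegularTetrahedron {r a : ℝ} (hr : 0 < r) (ha : 0 < a)
    {v : Fin 4 → Fin 4 → ℝ} (hv : IsRegularTetrahedron r a v) :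
    hyperbolicVolume r (geodesicTetrahedron r v)
      = ENNReal.ofReal (regularTetrahedronVolume r a) := by
  obtain ⟨hs0, hs1⟩ := inv_cosh_mem_Ioo (div_pos ha hr)
  have hC := Real.cosh_pos (a / r)
  -- This scaling makes the mixed products `-1`; the diagonal becomes `-s` with `s = 1 / cosh (a /
  -- r)`.
  have hk : 0 < (r * √(Real.cosh (a / r)))⁻¹ := by positivity
  have hk2 : (r * √(Real.cosh (a / r)))⁻¹ * (r * √(Real.cosh (a / r)))⁻¹
      = (r ^ 2 * Real.cosh (a / r))⁻¹ := by
    rw [← mul_inv, ← sq, mul_pow, Real.sq_sqrt hC.le]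
  rw [← geodesicTetrahedron_smul r v (fun _ => hk), hyperbolicVolume_geodesicTetrahedron hr hs0.le hs1
    (fun i => mul_pos hk (hv.1 i).2), regularTetrahedronVolume,
    ENNReal.ofReal_mul (q := (volume (gramRegion (Real.cosh (a / r))⁻¹)).toReal) (by positivity),
    ENNReal.ofReal_toReal (volume_gramRegion_lt_top hs0.le).ne]
  intro i j
  rw [minkowski_smul_smul, hk2]
  split_ifs with hij
  · rw [hij, (hv.1 j).1]
    field_simp
  · rw [minkowski_of_hyperbolicDist_eq hr ha (hv.2 i j hij)]
    field_simp

/-- Four vertices of a cube at spatial distance `√3 * α`, lifted to the time coordinate `β`. -/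
def cubeTetrahedron (α β : ℝ) : Fin 4 → Fin 4 → ℝ :=
  ![![α, α, α, β], ![α, -α, -α, β], ![-α, α, -α, β], ![-α, -α, α, β]]

theorem minkowski_cubeTetrahedron (α β : ℝ) (i j : Fin 4) :
    minkowski (cubeTetrahedron α β i) (cubeTetrahedron α β j)
      = if i = j then 3 * α ^ 2 - β ^ 2 else -α ^ 2 - β ^ 2 := by
  fin_cases i <;> fin_cases j <;> simp [minkowski, cubeTetrahedron] <;> ring

theorem cubeTetrahedron_apply_three (α β : ℝ) (i : Fin 4) : cubeTetrahedron α β i 3 = β := by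
  fin_cases i <;> rfl

theorem exists_isRegularTetrahedron {r a : ℝ} (hr : 0 < r) (ha : 0 < a) :
    ∃ v, IsRegularTetrahedron r a v := by
  have hC := Real.one_lt_cosh.2 (div_pos ha hr).ne'
  have h1 : √(r ^ 2 * (Real.cosh (a / r) - 1) / 4) ^ 2 = r ^ 2 * (Real.cosh (a / r) - 1) / 4 :=
    Real.sq_sqrt (div_nonneg (mul_nonneg (by positivity) (by linarith)) (by norm_num))
  have hpos : 0 < r ^ 2 * (3 * Real.cosh (a / r) + 1) / 4 := by
    have := Real.cosh_pos (a / r)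
    positivity
  have h2 : √(r ^ 2 * (3 * Real.cosh (a / r) + 1) / 4) ^ 2
      = r ^ 2 * (3 * Real.cosh (a / r) + 1) / 4 := Real.sq_sqrt hpos.le
  -- The values of `α` and `β` solve `3α² - β² = -r²` and `α² + β² = r² cosh (a / r)`.
  refine ⟨cubeTetrahedron (√(r ^ 2 * (Real.cosh (a / r) - 1) / 4))
    (√(r ^ 2 * (3 * Real.cosh (a / r) + 1) / 4)), fun i => ⟨?_, ?_⟩, fun i j hij => ?_⟩
  · rw [minkowski_cubeTetrahedron, if_pos rfl, h1, h2]
    ring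
  · rw [cubeTetrahedron_apply_three]
    exact Real.sqrt_pos.2 hpos
  · rw [hyperbolicDist, minkowski_cubeTetrahedron, if_neg hij, h1, h2]
    have h3 : -(-(r ^ 2 * (Real.cosh (a / r) - 1) / 4) - r ^ 2 * (3 * Real.cosh (a / r) + 1) / 4)
        / r ^ 2 = Real.cosh (a / r) := by
      field_simp
      ring
    rw [h3, Real.arcosh_cosh (div_pos ha hr).le]
    field_simp

theorem clausenTwo_pi_div_three_pos : 0 < clausenTwo (Real.pi / 3) := by
  have h := (abs_lt.1 abs_clausenTwo_pi_div_three_sub_lt).1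
  norm_num at h
  linarith

theorem toReal_volume_gramRegion_zero :
    (volume (gramRegion 0)).toReal = √3 / 12 * clausenTwo (Real.pi / 3) := by
  have := clausenTwo_pi_div_three_pos
  rw [volume_gramRegion_zero, ENNReal.toReal_ofReal (by positivity)]

/-- Ensures that `ENNReal.ofReal` truncates nothing, so the real bound and limit do concern the
volume. -/
theorem regularTetrahedronVolume_nonneg {r : ℝ} (hr : 0 < r) (a : ℝ) :
    0 ≤ regularTetrahedronVolume r a := by
  unfold regularTetrahedronVolume
  positivity

theorem regularTetrahedronVolume_le {r a : ℝ} (hr : 0 < r) (ha : 0 < a) :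
    regularTetrahedronVolume r a ≤ clausenTwo (Real.pi / 3) * r ^ 3 := by
  obtain ⟨hs0, hs1⟩ := inv_cosh_mem_Ioo (div_pos ha hr)
  unfold regularTetrahedronVolume
  set s := (Real.cosh (a / r))⁻¹
  have h1 : √((1 - s) ^ 3 * (3 + s)) ≤ √3 := by
    refine Real.sqrt_le_sqrt ?_
    -- `3 - (1 - s)³ (3 + s) = 2s + 6s(1 - s) + s⁴`.
    nlinarith [pow_pos hs0 4, mul_pos hs0 (sub_pos.2 hs1)]
  have h2 : (volume (gramRegion s)).toReal ≤ √3 / 12 * clausenTwo (Real.pi / 3) := by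
    rw [← toReal_volume_gramRegion_zero]
    exact ENNReal.toReal_mono (volume_gramRegion_lt_top le_rfl).ne
      (measure_mono (gramRegion_subset_gramRegion hs0.le))
  calc 4 * r ^ 3 * √((1 - s) ^ 3 * (3 + s)) * (volume (gramRegion s)).toReal
      ≤ 4 * r ^ 3 * √3 * (√3 / 12 * clausenTwo (Real.pi / 3)) := by gcongr
    _ = clausenTwo (Real.pi / 3) * r ^ 3 := by
      linear_combination r ^ 3 * clausenTwo (Real.pi / 3) / 3 *
        Real.sq_sqrt (show (0 : ℝ) ≤ 3 by norm_num)

theorem tendsto_cosh_atTop : Tendsto Real.cosh atTop atTop := by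
  refine tendsto_atTop_mono (fun x => ?_) (Real.tendsto_exp_atTop.atTop_div_const two_pos)
  rw [Real.cosh_eq]
  have := Real.exp_pos (-x)
  linarith

theorem tendsto_regularTetrahedronVolume {r : ℝ} (hr : 0 < r) :
    Tendsto (regularTetrahedronVolume r) atTop (𝓝 (clausenTwo (Real.pi / 3) * r ^ 3)) := by
  have hs : Tendsto (fun a : ℝ => (Real.cosh (a / r))⁻¹) atTop (𝓝[>] 0) :=
    tendsto_inv_atTop_nhdsGT_zero.comp
      (tendsto_cosh_atTop.comp (tendsto_id.atTop_div_const hr))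
  have h1 : Tendsto (fun s : ℝ => 4 * r ^ 3 * √((1 - s) ^ 3 * (3 + s))) (𝓝[>] 0)
      (𝓝 (4 * r ^ 3 * √((1 - 0) ^ 3 * (3 + 0)))) :=
    tendsto_nhdsWithin_of_tendsto_nhds (Continuous.tendsto (by fun_prop) 0)
  have h2 := (ENNReal.tendsto_toReal (volume_gramRegion_lt_top le_rfl).ne).comp
    tendsto_volume_gramRegion
  have h3 := (h1.mul h2).comp hs
  have e : 4 * r ^ 3 * √((1 - 0) ^ 3 * (3 + 0)) * (volume (gramRegion 0)).toReal
      = clausenTwo (Real.pi / 3) * r ^ 3 := by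
    rw [toReal_volume_gramRegion_zero, sub_zero, one_pow, one_mul, add_zero]
    linear_combination r ^ 3 * clausenTwo (Real.pi / 3) / 3 *
      Real.sq_sqrt (show (0 : ℝ) ≤ 3 by norm_num)
  rw [← e]
  exact h3

/-! ### Regular ideal tetrahedra -/

theorem minkowski_combinationMap_combinationMap (w : Fin 4 → Fin 4 → ℝ) (c d : Fin 4 → ℝ) :
    minkowski (combinationMap w c) (combinationMap w d)
      = ∑ i, ∑ j, c i * d j * minkowski (w i) (w j) := by
  simp only [combinationMap_apply, minkowski, Fin.sum_univ_four, Pi.add_apply, Pi.smul_apply,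
    smul_eq_mul]
  ring

/-- Four alternate cube vertices, lifted to the light cone, form a basis whose Gram matrix is
invariant under permutations, so permuting the basis is an isometry. It fixes the time coordinate
because all four vectors have the same height. -/
theorem exists_isRegularIdealTetrahedron (r : ℝ) : ∃ u, IsRegularIdealTetrahedron r u := by
  have h3 : √3 ^ 2 = 3 := Real.sq_sqrt (by norm_num)
  set u := cubeTetrahedron (1 / 2) (√3 / 2) with hu
  have hG (i j : Fin 4) : minkowski (u i) (u j) = if i = j then -0 else -1 := by
    rw [hu, minkowski_cubeTetrahedron]
    congr 1
    · linear_combination -h3 / 4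
    · linear_combination -h3 / 4
  have hu3 (i : Fin 4) : u i 3 = √3 / 2 := cubeTetrahedron_apply_three _ _ i
  have hdet : LinearMap.det (combinationMap u) ≠ 0 := by
    intro h0
    have h := sq_det_combinationMap hG
    rw [h0] at h
    norm_num at h
  refine ⟨u, fun i => ⟨by simp [hG], by rw [hu3]; positivity⟩, fun i j hij t ht => ?_, fun σ => ?_⟩
  · have h1 := hG i j
    rw [if_neg hij, ht, ← one_smul ℝ (u j), smul_smul, minkowski_smul_smul, hG j j] at h1
    simp at h1
  · set A := (combinationMap u).equivOfDetNeZero hdet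
    have hA (c : Fin 4 → ℝ) : A c = combinationMap u c := rfl
    set L : (Fin 4 → ℝ) →ₗ[ℝ] (Fin 4 → ℝ) :=
      combinationMap (fun i => u (σ i)) ∘ₗ A.symm.toLinearMap
    have hL (c : Fin 4 → ℝ) : L (A c) = combinationMap (fun i => u (σ i)) c := by
      simp [L]
    have hm (X Y : Fin 4 → ℝ) : minkowski (L X) (L Y) = minkowski X Y := by
      rw [← A.apply_symm_apply X, ← A.apply_symm_apply Y, hL, hL, hA, hA,
        minkowski_combinationMap_combinationMap, minkowski_combinationMap_combinationMap]
      simp only [hG, σ.injective.eq_iff]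
    have hL3 (X : Fin 4 → ℝ) : L X 3 = X 3 := by
      rw [← A.apply_symm_apply X, hL, hA, combinationMap_apply, combinationMap_apply]
      simp [Finset.sum_apply, hu3]
    refine ⟨L, ⟨hm, fun X hX => ⟨(hm X X).trans hX.1, (hL3 X).symm ▸ hX.2⟩⟩,
      fun i => ⟨1, one_pos, ?_⟩⟩
    have hui : u i = A (Pi.single i 1) := by
      rw [hA, combinationMap_apply]
      simp [Pi.single_apply]
    rw [hui, hL, combinationMap_apply]
    simp [Pi.single_apply]

/-- For lightlike vectors the spatial part of `v₃ u - u₃ v` has squared length `-2 u₃ v₃ ⟨u, v⟩`,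
and it vanishes only if the rays agree. -/
theorem minkowski_neg_of_lightlike {u v : Fin 4 → ℝ} (hu : minkowski u u = 0 ∧ 0 < u 3)
    (hv : minkowski v v = 0 ∧ 0 < v 3) (huv : ∀ t : ℝ, u ≠ t • v) : minkowski u v < 0 := by
  obtain ⟨hu, hu3⟩ := hu
  obtain ⟨hv, hv3⟩ := hv
  have key : (v 3 * u 0 - u 3 * v 0) ^ 2 + (v 3 * u 1 - u 3 * v 1) ^ 2
      + (v 3 * u 2 - u 3 * v 2) ^ 2 = -(2 * (u 3 * v 3)) * minkowski u v := by
    unfold minkowski at *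
    linear_combination v 3 ^ 2 * hu + u 3 ^ 2 * hv
  by_contra! h
  have h0 : (v 3 * u 0 - u 3 * v 0) ^ 2 + (v 3 * u 1 - u 3 * v 1) ^ 2
      + (v 3 * u 2 - u 3 * v 2) ^ 2 ≤ 0 := by
    rw [key, neg_mul]
    have : 0 ≤ 2 * (u 3 * v 3) * minkowski u v := by positivity
    linarith
  have e0 : v 3 * u 0 - u 3 * v 0 = 0 := by
    refine pow_eq_zero_iff two_ne_zero |>.1 (le_antisymm ?_ (sq_nonneg _))
    linarith [sq_nonneg (v 3 * u 1 - u 3 * v 1), sq_nonneg (v 3 * u 2 - u 3 * v 2)]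
  have e1 : v 3 * u 1 - u 3 * v 1 = 0 := by
    refine pow_eq_zero_iff two_ne_zero |>.1 (le_antisymm ?_ (sq_nonneg _))
    linarith [sq_nonneg (v 3 * u 0 - u 3 * v 0), sq_nonneg (v 3 * u 2 - u 3 * v 2)]
  have e2 : v 3 * u 2 - u 3 * v 2 = 0 := by
    refine pow_eq_zero_iff two_ne_zero |>.1 (le_antisymm ?_ (sq_nonneg _))
    linarith [sq_nonneg (v 3 * u 0 - u 3 * v 0), sq_nonneg (v 3 * u 1 - u 3 * v 1)]
  refine huv (u 3 / v 3) (funext fun i => ?_)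
  rw [Pi.smul_apply, smul_eq_mul, div_mul_eq_mul_div, eq_div_iff hv3.ne']
  fin_cases i
  · show u 0 * v 3 = u 3 * v 0
    linarith
  · show u 1 * v 3 = u 3 * v 1
    linarith
  · show u 2 * v 3 = u 3 * v 2
    linarith
  · show u 3 * v 3 = u 3 * v 3
    rfl

/-- Lightlike representatives are defined only up to scale, so the invariants of the six products `l
i j` are the ratios of the three products over opposite edges. Symmetry makes these three equal, and
then four positive scale factors normalise all six products to `1`, which is the case `s = 0`. -/
theorem hyperbolicVolume_of_isRegularIdealTetrahedron {r : ℝ} (hr : 0 < r)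
    {u : Fin 4 → Fin 4 → ℝ} (hu : IsRegularIdealTetrahedron r u) :
    hyperbolicVolume r (geodesicTetrahedron r u)
      = ENNReal.ofReal (clausenTwo (Real.pi / 3) * r ^ 3) := by
  obtain ⟨hlight, hdist, hperm⟩ := hu
  set l : Fin 4 → Fin 4 → ℝ := fun i j => -minkowski (u i) (u j) with hl
  have hpos (i j : Fin 4) (hij : i ≠ j) : 0 < l i j :=
    neg_pos.2 (minkowski_neg_of_lightlike (hlight i) (hlight j) (hdist i j hij))
  have hsymm (i j : Fin 4) : l i j = l j i := by simp only [hl, minkowski_comm]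
  have hσ (σ : Equiv.Perm (Fin 4)) : ∃ t : Fin 4 → ℝ,
      ∀ i j, l i j = t i * t j * l (σ i) (σ j) := by
    obtain ⟨L, hL, h⟩ := hperm σ
    choose t _ ht using h
    refine ⟨t, fun i j => ?_⟩
    simp only [hl]
    rw [← hL.1, ht, ht, minkowski_smul_smul, mul_neg]
  -- A transposition exchanges two opposite-edge products up to the same factor `T = t₀ t₁ t₂ t₃` in
  -- both directions, whence `p² = q²`.
  have hsq {p q T : ℝ} (hp : 0 < p) (hq : 0 < q) (h1 : p = T * q) (h2 : q = T * p) : p = q := by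
    have : p ^ 2 = q ^ 2 := by linear_combination p * h1 - q * h2
    exact (pow_left_inj₀ hp.le hq.le two_ne_zero).1 this
  have p01 := hpos 0 1 (by decide)
  have p02 := hpos 0 2 (by decide)
  have p03 := hpos 0 3 (by decide)
  have p12 := hpos 1 2 (by decide)
  have p13 := hpos 1 3 (by decide)
  have p23 := hpos 2 3 (by decide)
  have r1 : l 0 1 * l 2 3 = l 0 2 * l 1 3 := by
    obtain ⟨t, ht⟩ := hσ (Equiv.swap 1 2)
    have s0 : Equiv.swap (1 : Fin 4) 2 0 = 0 := by decide
    have s1 : Equiv.swap (1 : Fin 4) 2 1 = 2 := by decide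
    have s2 : Equiv.swap (1 : Fin 4) 2 2 = 1 := by decide
    have s3 : Equiv.swap (1 : Fin 4) 2 3 = 3 := by decide
    have a1 := ht 0 1
    have a2 := ht 2 3
    have a3 := ht 0 2
    have a4 := ht 1 3
    rw [s0, s1] at a1
    rw [s2, s3] at a2
    rw [s0, s2] at a3
    rw [s1, s3] at a4
    refine hsq (T := t 0 * t 1 * t 2 * t 3) (by positivity) (by positivity) ?_ ?_
    · nth_rw 1 [a1, a2]
      ring
    · nth_rw 1 [a3, a4]
      ring
  have r2 : l 0 1 * l 2 3 = l 0 3 * l 1 2 := by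
    obtain ⟨t, ht⟩ := hσ (Equiv.swap 1 3)
    have s0 : Equiv.swap (1 : Fin 4) 3 0 = 0 := by decide
    have s1 : Equiv.swap (1 : Fin 4) 3 1 = 3 := by decide
    have s2 : Equiv.swap (1 : Fin 4) 3 2 = 2 := by decide
    have s3 : Equiv.swap (1 : Fin 4) 3 3 = 1 := by decide
    have a1 := ht 0 1
    have a2 := ht 2 3
    have a3 := ht 0 3
    have a4 := ht 1 2
    rw [s0, s1] at a1
    rw [s2, s3, hsymm 2 1] at a2
    rw [s0, s3] at a3
    rw [s1, s2, hsymm 3 2] at a4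
    refine hsq (T := t 0 * t 1 * t 2 * t 3) (by positivity) (by positivity) ?_ ?_
    · nth_rw 1 [a1, a2]
      ring
    · nth_rw 1 [a3, a4]
      ring
  -- The factors `k 1`, `k 2`, `k 3` are forced by the products with vertex `0`; this `κ` then
  -- normalises `l 1 2`, and `r1`, `r2` take care of `l 1 3` and `l 2 3`.
  set κ := √(l 1 2 / (l 0 1 * l 0 2)) with hκ
  have hκ0 : 0 < κ := Real.sqrt_pos.2 (by positivity)
  have hκ2 : κ ^ 2 * (l 0 1 * l 0 2) = l 1 2 := by
    rw [hκ, Real.sq_sqrt (by positivity)]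
    field_simp
  set k : Fin 4 → ℝ := ![κ, (κ * l 0 1)⁻¹, (κ * l 0 2)⁻¹, (κ * l 0 3)⁻¹] with hk
  have hkpos (i : Fin 4) : 0 < k i := by
    fin_cases i <;> simp [hk] <;> positivity
  have g01 : k 0 * k 1 * l 0 1 = 1 := by
    simp only [hk, Matrix.cons_val]
    field_simp
  have g02 : k 0 * k 2 * l 0 2 = 1 := by
    simp only [hk, Matrix.cons_val]
    field_simp
  have g03 : k 0 * k 3 * l 0 3 = 1 := by
    simp only [hk, Matrix.cons_val]
    field_simp
  have g12 : k 1 * k 2 * l 1 2 = 1 := by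
    simp only [hk, Matrix.cons_val]
    field_simp
    linarith
  have g13 : k 1 * k 3 * l 1 3 = 1 := by
    simp only [hk, Matrix.cons_val]
    field_simp
    refine mul_right_cancel₀ p02.ne' ?_
    linear_combination -r1 + r2 - l 0 3 * hκ2
  have g23 : k 2 * k 3 * l 2 3 = 1 := by
    simp only [hk, Matrix.cons_val]
    field_simp
    refine mul_right_cancel₀ p01.ne' ?_
    linear_combination r2 - l 0 3 * hκ2
  have hG (i j : Fin 4) : minkowski (k i • u i) (k j • u j) = if i = j then -0 else -1 := by
    have hoff : ∀ i j, i < j → k i * k j * l i j = 1 := by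
      intro i j hij
      fin_cases i <;> fin_cases j <;> first | exact absurd hij (by decide) | assumption
    rw [minkowski_smul_smul]
    split_ifs with hij
    · rw [hij, (hlight j).1, mul_zero, neg_zero]
    · rcases lt_or_gt_of_ne hij with h | h
      · have := hoff i j h
        simp only [hl] at this
        linarith
      · have := hoff j i h
        rw [hsymm] at this
        simp only [hl] at this
        linarith
  have hcl := clausenTwo_pi_div_three_pos
  rw [← geodesicTetrahedron_smul r u hkpos, hyperbolicVolume_geodesicTetrahedron hr le_rfl one_pos
    (fun i => mul_pos (hkpos i) (hlight i).2) hG, volume_gramRegion_zero,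
    ← ENNReal.ofReal_mul (by positivity)]
  congr 1
  rw [sub_zero, one_pow, one_mul, add_zero]
  linear_combination r ^ 3 * clausenTwo (Real.pi / 3) / 3 *
    Real.sq_sqrt (show (0 : ℝ) ≤ 3 by norm_num)

theorem mainTheorem4 (r : ℝ) (hr : 0 < r) :
    -- the volume `V a` of the regular tetrahedron of edge length `a`: its bound and its limit
    (∃ V : ℝ → ℝ,
      (∀ a : ℝ, 0 < a →
        (∃ v, IsRegularTetrahedron r a v) ∧
        (∀ v, IsRegularTetrahedron r a v →
          hyperbolicVolume r (geodesicTetrahedron r v) = ENNReal.ofReal (V a)) ∧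
        0 ≤ V a ∧ V a ≤ clausenTwo (Real.pi / 3) * r ^ 3) ∧
      Tendsto V atTop (𝓝 (clausenTwo (Real.pi / 3) * r ^ 3))) ∧
    -- the limit is the volume of the regular ideal tetrahedron
    (∃ u, IsRegularIdealTetrahedron r u) ∧
    (∀ u, IsRegularIdealTetrahedron r u →
      hyperbolicVolume r (geodesicTetrahedron r u) =
        ENNReal.ofReal (clausenTwo (Real.pi / 3) * r ^ 3)) ∧
    -- the other expressions of the constant
    clausenTwo (Real.pi / 3) = (dilog (Complex.exp (Complex.I * (Real.pi / 3)))).im ∧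
    clausenTwo (Real.pi / 3) = √3 / 6 * (trigamma (1 / 3) - 2 / 3 * Real.pi ^ 2) ∧
    |clausenTwo (Real.pi / 3) - 1.0149416064096536250| < 5 / 10 ^ 20 := by
  refine ⟨⟨regularTetrahedronVolume r, fun a ha => ⟨exists_isRegularTetrahedron hr ha,
      fun v hv => hyperbolicVolume_of_isRegularTetrahedron hr ha hv,
      regularTetrahedronVolume_nonneg hr a, regularTetrahedronVolume_le hr ha⟩,
      tendsto_regularTetrahedronVolume hr⟩, exists_isRegularIdealTetrahedron r,
    fun u hu => hyperbolicVolume_of_isRegularIdealTetrahedron hr hu, ?_,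
    clausenTwo_pi_div_three_eq_trigamma, abs_clausenTwo_pi_div_three_sub_lt⟩
  rw [← im_dilog_exp]
  push_cast
  rfl
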